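/- **Setting.** Let $r:\mathbb R^n\to\mathbb R^m$ be continuously differentiable with Jacobian $J$, and $f=\frac12\|r\|^2$, so that $\nabla f(x)=J(x)^\top r(x)$. *Algorithm.* Fix $\eta_1\in(0,1)$, $\eta_2,\mu_{\min}>0$, $\lambda>1$, a starting point $x_0$ and $\mu_0\ge\mu_{\min}$; set $X_0=x_0$. At iteration $j\ge 0$ one has an iterate $X_j$ and a parameter $\mu_j$. One computes a random model $M_j$, given by its value $M_j(X_j)\in\mathbb R$, a gradient estimate $g_j\in\mathbb R^n$ and a Jacobian estimate $J_{M_j}\in\mathbb R^{m\times n}$, through $$M_j(X_j+s)=M_j(X_j)+g_j^\top s+\tfrac12 s^\top(J_{M_j}^\top J_{M_j}+\gamma_jI)s,\qquad \gamma_j=\mu_j\|g_j\|;$$ then a step $S_j$, determined by the information available once $M_j$ is known; then random estimates $F_j^0,F_j^1$ of $f(X_j)$, $f(X_j+S_j)$, and $\rho_j=\frac{F_j^0-F_j^1}{M_j(X_j)-M_j(X_j+S_j)}$. If $\rho_j\ge\eta_1$ and $\|g_j\|\ge\eta_2/\mu_j$, then $X_{j+1}=X_j+S_j$ and $\mu_{j+1}=\max\{\mu_j/\lambda,\mu_{\min}\}$;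 otherwise $X_{j+1}=X_j$ and $\mu_{j+1}=\lambda\mu_j$. Let $\mathcal F_{j-1}=\sigma(M_0,\dots,M_{j-1},F_0^0,F_0^1,\dots,F_{j-1}^0,F_{j-1}^1)$ and $\mathcal F_{j-1/2}=\sigma(M_0,\dots,M_j,F_0^0,F_0^1,\dots,F_{j-1}^0,F_{j-1}^1)$; $S_j$ is $\mathcal F_{j-1/2}$-measurable. *Assumptions.* Let $\kappa_{ef},\kappa_{eg},\varepsilon_f,\kappa_{J_m},\theta_{fcd},\theta_{in}>0$, $\nu\ge0$ and $p,q\in(0,1]$. For all $j$ and all realizations: 1. $f$ is continuously differentiable with $\nu$-Lipschitz gradient on an open set that contains $\{x: f(x)\le f(x_0)\}$ and all segments $[X_j,X_j+S_j]$; 2. $\|J_{M_j}\|\le\kappa_{J_m}$; 3. $M_j(X_j)-M_j(X_j+S_j)\ge\frac{\theta_{fcd}}2\frac{\|g_j\|^2}{\|J_{M_j}\|^2+\gamma_j}$ (the right-hand side being read as $0$ if $g_j=0$); 4. $\|S_j\|\le 2/\mu_j$ and $|S_j^\top(\gamma_jS_j+g_j)|\le(4\|J_{M_j}\|^2+2\theta_{in})/\mu_j^2$;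 5. almost surely $\Pr(U_j\mid\mathcal F_{j-1})\ge p$, where $U_j=\{\|g_j-J(X_j)^\top r(X_j)\|\le\kappa_{eg}/\mu_j,\ |f(X_j)-M_j(X_j)|\le\kappa_{ef}/\mu_j^2\}$; 6. almost surely $\Pr(V_j\mid\mathcal F_{j-1/2})\ge q$, where $V_j=\{|F_j^0-f(X_j)|\le\varepsilon_f/\mu_j^2,\ |F_j^1-f(X_j+S_j)|\le\varepsilon_f/\mu_j^2\}$. Put $\kappa_{efs}=\frac{\kappa_{ef}+2\kappa_{eg}+\nu+4\kappa_{J_m}^2}2$, $\alpha=\frac{2}{\theta_{fcd}}(\varepsilon_f+\kappa_{eg}+\nu+5\kappa_{J_m}^2+2\theta_{in})$, $\kappa_{\mu g}=\max\Big\{\frac{\alpha+\sqrt{\alpha^2+4\alpha\kappa_{J_m}^2(1-\eta_1)}}{2(1-\eta_1)},\eta_2\Big\}$, $B=\max\Big\{\kappa_{J_m}^2,\frac{8(\kappa_{ef}+\kappa_{efs})}{\eta_1\theta_{fcd}}\Big\}$, $C_1=\frac{\eta_1\theta_{fcd}}8\frac{B}{\kappa_{eg}+B}$, $C_2=\frac{\eta_1\eta_2\theta_{fcd}}4-2\varepsilon_f$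 and $C_3=2(1+\nu/\zeta)$. Let $\zeta$ and $\tau\in(0,1)$ be such that - $\eta_2\ge\max\{\kappa_{J_m}^2,\frac{6(\kappa_{ef}+\kappa_{efs})}{\theta_{fcd}},\frac{8\varepsilon_f}{\eta_1\theta_{fcd}}\}$ and $C_2>0$; - $\zeta\ge\kappa_{eg}+\max\{\kappa_{\mu g},\frac{8(\kappa_{ef}+\kappa_{efs})}{\eta_1\theta_{fcd}},\kappa_{J_m}^2,\eta_2\}$; - $\frac\tau{1-\tau}>\max\Big\{\frac{\lambda^2-\lambda^{-2}}{C_1\zeta},\frac{\lambda^2-\lambda^{-2}}{C_2},\frac{\lambda^2-\lambda^{-2}}{(\kappa_{ef}+\kappa_{efs})/2}\Big\}$; - $pq>\frac12$, $\ pq-\frac12\ge\frac{C_3}{C_1}(1-p)(1-q)$, and $(1-p)(1-q)\le\frac{(1-\tau)(1-\lambda^{-2})}{2(\tau C_3\zeta+(1-\tau)(\lambda^2-1))}$. Assume that $\Phi_j=\tau f(X_j)+(1-\tau)/\mu_j^2$ is bounded above by a constant $\Phi_{\max}>0$, uniformly in $j$ and in the realization. Let $\epsilon>0$, $\mu_\epsilon=\zeta/\epsilon$,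 and let $\mu_0=\mu_\epsilon/\lambda^s$, $\mu_{\min}=\mu_\epsilon/\lambda^t$ for some integers $s,t>0$. Put $\sigma=\frac14(1-\tau)(1-\lambda^{-2})$ and $T_\epsilon=\inf\{j\ge0:\|\nabla f(X_j)\|\le\epsilon\}$ ($=+\infty$ if there is no such $j$). **Theorem.** Then $$\mathbb E[T_\epsilon]\le\frac{pq}{2pq-1}\left(\frac{\Phi_0}{\sigma}\mu_\epsilon^2+1\right)-1,$$ equivalently $$\mathbb E[T_\epsilon]\le\frac{pq}{2pq-1}\left(\kappa_s\epsilon^{-2}+1\right)-1,\qquad \kappa_s=\frac{\tau f(x_0)+(1-\tau)\mu_0^{-2}}{\frac14(1-\tau)(1-\lambda^{-2})}\,\zeta^2 .$$ -/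

import Mathlib

open MeasureTheory Set
open scoped ENNReal NNReal

noncomputable section

namespace StochLM

/-- `ℝᵈ` with its Euclidean norm. -/
abbrev Vec (d : ℕ) : Type := EuclideanSpace ℝ (Fin d)

/-! ### The least-squares problem -/

/-- The objective `f = ½ ‖r‖²`. -/
def obj {n m : ℕ} (r : Vec n → Vec m) (x : Vec n) : ℝ := 1 / 2 * ‖r x‖ ^ 2

/-- `J(x)ᵀ r(x)`, where `J` is the Jacobian of `r`. -/
def jacTRes {n m : ℕ} (r : Vec n → Vec m) (x : Vec n) : Vec n :=
  ContinuousLinearMap.adjoint (fderiv ℝ r x) (r x)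

/-! ### The regularized Gauss-Newton model -/

/-- The data of a model around the current iterate: the value of the model at the iterate, the
gradient estimate and the Jacobian estimate.  Together with the parameter `μ` they determine
the model. -/
abbrev Model (n m : ℕ) : Type := ℝ × Vec n × (Vec n →L[ℝ] Vec m)

/-- The value `m(x)` of the model at the current iterate. -/
def Model.val {n m : ℕ} (M : Model n m) : ℝ := M.1

/-- The gradient estimate. -/
def Model.grad {n m : ℕ} (M : Model n m) : Vec n := M.2.1

/-- The Jacobian estimate. -/
def Model.jac {n m : ℕ} (M : Model n m) : Vec n →L[ℝ] Vec m := M.2.2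

/-- The regularization parameter `γ = μ ‖g‖`. -/
def Model.reg {n m : ℕ} (M : Model n m) (μ : ℝ) : ℝ := μ * ‖M.grad‖

/-- `m(x + s) = m(x) + gᵀ s + ½ sᵀ (Jᵀ J + γ I) s`, as a function of the step `s`. -/
def Model.eval {n m : ℕ} (M : Model n m) (μ : ℝ) (s : Vec n) : ℝ :=
  M.val + inner ℝ M.grad s
    + 1 / 2 * inner ℝ s (ContinuousLinearMap.adjoint M.jac (M.jac s) + M.reg μ • s)

/-- The model decrease `m(x) - m(x + s)`. -/
def Model.decrease {n m : ℕ} (M : Model n m) (μ : ℝ) (s : Vec n) : ℝ :=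
  M.eval μ 0 - M.eval μ s

/-! ### The algorithm -/

/-- The parameters of the algorithm. -/
structure Params where
  η₁ : ℝ
  η₂ : ℝ
  μmin : ℝ
  lam : ℝ
  η₁_pos : 0 < η₁
  η₁_lt_one : η₁ < 1
  η₂_pos : 0 < η₂
  μmin_pos : 0 < μmin
  one_lt_lam : 1 < lam

/-- Everything that is computed during one iteration: the model, the trial step, and the
estimates `f⁰` of `f(x)` and `f¹` of `f(x + s)`. -/
structure IterData (n m : ℕ) where
  M : Model n m
  s : Vec n
  f0 : ℝ
  f1 : ℝ

/-- The ratio `ρ` of estimated decrease to model decrease. -/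
def ratio {n m : ℕ} (D : IterData n m) (μ : ℝ) : ℝ :=
  (D.f0 - D.f1) / D.M.decrease μ D.s

/-- The iteration is successful: `ρ ≥ η₁` and `‖g‖ ≥ η₂ / μ`. -/
def Successful {n m : ℕ} (A : Params) (D : IterData n m) (μ : ℝ) : Prop :=
  A.η₁ ≤ ratio D μ ∧ A.η₂ / μ ≤ ‖D.M.grad‖

open Classical in
/-- The pair `(x_j, μ_j)` generated by the algorithm from `(x₀, μ₀)` when the quantities computed
at iteration `i` are `D i`. -/
def state {n m : ℕ} (A : Params) (x₀ : Vec n) (μ₀ : ℝ) (D : ℕ → IterData n m) :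
    ℕ → Vec n × ℝ
  | 0 => (x₀, μ₀)
  | j + 1 =>
    let x := (state A x₀ μ₀ D j).1
    let μ := (state A x₀ μ₀ D j).2
    if Successful A (D j) μ then (x + (D j).s, max (μ / A.lam) A.μmin)
    else (x, A.lam * μ)

/-! ### Randomness -/

section Random

variable {Ω : Type*} {n m : ℕ}

/-- The `σ`-algebra generated by the models and the function estimates of the iterations
`0, …, j - 1` (trivial for `j = 0`): the information available at the start of iteration `j`. -/
abbrev history (M : ℕ → Ω → Model n m) (F0 F1 : ℕ → Ω → ℝ) (j : ℕ) : MeasurableSpace Ω :=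
  ⨆ i : ℕ, ⨆ _ : i < j,
    MeasurableSpace.comap (M i) inferInstance ⊔
      (MeasurableSpace.comap (F0 i) inferInstance ⊔ MeasurableSpace.comap (F1 i) inferInstance)

/-- The `σ`-algebra generated by the models of the iterations `0, …, j` and the function estimates
of the iterations `0, …, j - 1`. -/
abbrev halfHistory (M : ℕ → Ω → Model n m) (F0 F1 : ℕ → Ω → ℝ) (j : ℕ) : MeasurableSpace Ω :=
  history M F0 F1 j ⊔ MeasurableSpace.comap (M j) inferInstance

end Random

/-- The random quantities of the algorithm.  The models and the function estimates are random
variables, and the trial step of iteration `j` is computed from the information available once the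
`j`-th model is known. -/
structure Noise (Ω : Type*) [MeasurableSpace Ω] (n m : ℕ) where
  M : ℕ → Ω → Model n m
  S : ℕ → Ω → Vec n
  F0 : ℕ → Ω → ℝ
  F1 : ℕ → Ω → ℝ
  measurable_M : ∀ j, Measurable (M j)
  measurable_F0 : ∀ j, Measurable (F0 j)
  measurable_F1 : ∀ j, Measurable (F1 j)
  measurable_S : ∀ j, Measurable[halfHistory M F0 F1 j] (S j)

/-- An execution of the algorithm on random data. -/
structure Run (Ω : Type*) [MeasurableSpace Ω] (n m : ℕ) extends Noise Ω n m where
  A : Params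
  x₀ : Vec n
  μ₀ : ℝ
  μmin_le : A.μmin ≤ μ₀

section Run

variable {Ω : Type*} [MeasurableSpace Ω] {n m : ℕ} (R : Run Ω n m)

/-- The random iterate `X_j`. -/
def Run.X (j : ℕ) (ω : Ω) : Vec n :=
  (state R.A R.x₀ R.μ₀ (fun i => ⟨R.M i ω, R.S i ω, R.F0 i ω, R.F1 i ω⟩) j).1

/-- The random parameter `μ_j`. -/
def Run.mu (j : ℕ) (ω : Ω) : ℝ :=
  (state R.A R.x₀ R.μ₀ (fun i => ⟨R.M i ω, R.S i ω, R.F0 i ω, R.F1 i ω⟩) j).2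

/-- The event `U_j` that the `j`-th model is `(κ_ef, κ_eg)`-first-order accurate. -/
def Run.modelAccurate (r : Vec n → Vec m) (κef κeg : ℝ) (j : ℕ) : Set Ω :=
  {ω | ‖(R.M j ω).grad - jacTRes r (R.X j ω)‖ ≤ κeg / R.mu j ω ∧
    |obj r (R.X j ω) - (R.M j ω).val| ≤ κef / R.mu j ω ^ 2}

/-- The event `V_j` that the `j`-th function estimates are `ε_f`-accurate. -/
def Run.estimatesAccurate (r : Vec n → Vec m) (εf : ℝ) (j : ℕ) : Set Ω :=
  {ω | |R.F0 j ω - obj r (R.X j ω)| ≤ εf / R.mu j ω ^ 2 ∧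
    |R.F1 j ω - obj r (R.X j ω + R.S j ω)| ≤ εf / R.mu j ω ^ 2}

/-- The models are `p`-probabilistically `(κ_ef, κ_eg)`-first-order accurate: almost surely, the
conditional probability of `U_j` given the history is at least `p`. -/
def Run.ProbModelAccurate (P : Measure Ω) (r : Vec n → Vec m) (κef κeg p : ℝ) : Prop :=
  ∀ j, ∀ᵐ ω ∂P,
    p ≤ (P[(R.modelAccurate r κef κeg j).indicator (fun _ => (1 : ℝ)) |
      history R.M R.F0 R.F1 j]) ω

/-- The estimates are `q`-probabilistically `ε_f`-accurate: almost surely, the conditional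
probability of `V_j` given the history and the `j`-th model is at least `q`. -/
def Run.ProbEstimatesAccurate (P : Measure Ω) (r : Vec n → Vec m) (εf q : ℝ) : Prop :=
  ∀ j, ∀ᵐ ω ∂P,
    q ≤ (P[(R.estimatesAccurate r εf j).indicator (fun _ => (1 : ℝ)) |
      halfHistory R.M R.F0 R.F1 j]) ω

/-- `f` is continuously differentiable with `ν`-Lipschitz gradient on an open set that contains the
level set of `x₀` and, for every realization, all segments from an iterate to its trial point. -/
def Run.SmoothObjective (r : Vec n → Vec m) (ν : ℝ≥0) : Prop :=
  ∃ O : Set (Vec n), IsOpen O ∧ {x | obj r x ≤ obj r R.x₀} ⊆ O ∧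
    (∀ j ω, segment ℝ (R.X j ω) (R.X j ω + R.S j ω) ⊆ O) ∧
    ContDiffOn ℝ 1 (obj r) O ∧ LipschitzOnWith ν (gradient (obj r)) O

/-- The model Jacobians are bounded by `κ_J`. -/
def Run.BoundedJacobians (κJ : ℝ) : Prop :=
  ∀ j ω, ‖(R.M j ω).jac‖ ≤ κJ

/-- The trial steps achieve a fraction of the Cauchy decrease. -/
def Run.CauchyDecrease (θfcd : ℝ) : Prop :=
  ∀ j ω, θfcd / 2 * (‖(R.M j ω).grad‖ ^ 2 /
      (‖(R.M j ω).jac‖ ^ 2 + (R.M j ω).reg (R.mu j ω)))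
    ≤ (R.M j ω).decrease (R.mu j ω) (R.S j ω)

/-- `‖s‖ ≤ 2 / μ` and `|sᵀ (γ s + g)| ≤ (4 ‖J‖² + 2 θ_in) / μ²`. -/
def Run.StepBounds (θin : ℝ) : Prop :=
  ∀ j ω, ‖R.S j ω‖ ≤ 2 / R.mu j ω ∧
    |inner ℝ (R.S j ω) ((R.M j ω).reg (R.mu j ω) • R.S j ω + (R.M j ω).grad)|
      ≤ (4 * ‖(R.M j ω).jac‖ ^ 2 + 2 * θin) / R.mu j ω ^ 2

/-- `Φ_j = τ f(X_j) + (1 - τ) / μ_j²`. -/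
def Run.Phi (r : Vec n → Vec m) (τ : ℝ) (j : ℕ) (ω : Ω) : ℝ :=
  τ * obj r (R.X j ω) + (1 - τ) / R.mu j ω ^ 2

/-- `T_ε`, the first iteration with `‖∇f(X_j)‖ ≤ ε` (`⊤` if there is none). -/
def Run.hit (r : Vec n → Vec m) (ε : ℝ) (ω : Ω) : ℕ∞ :=
  ⨅ j : ℕ, ⨅ _ : ‖gradient (obj r) (R.X j ω)‖ ≤ ε, (j : ℕ∞)

end Run

/-! ### Constants -/

/-- The constants in the assumptions of the analysis. -/
structure Consts where
  κef : ℝ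
  κeg : ℝ
  εf : ℝ
  κJ : ℝ
  θfcd : ℝ
  θin : ℝ
  ν : ℝ≥0
  κef_pos : 0 < κef
  κeg_pos : 0 < κeg
  εf_pos : 0 < εf
  κJ_pos : 0 < κJ
  θfcd_pos : 0 < θfcd
  θin_pos : 0 < θin

section Consts

variable (A : Params) (K : Consts)

def Consts.κefs : ℝ := (K.κef + 2 * K.κeg + K.ν + 4 * K.κJ ^ 2) / 2

def Consts.α : ℝ := 2 * (K.εf + K.κeg + K.ν + 5 * K.κJ ^ 2 + 2 * K.θin) / K.θfcd

def Consts.κμg : ℝ :=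
  max ((K.α + √(K.α ^ 2 + 4 * K.α * K.κJ ^ 2 * (1 - A.η₁))) / (2 * (1 - A.η₁))) A.η₂

def Consts.C₁ : ℝ :=
  A.η₁ * K.θfcd / 8 *
    (max (K.κJ ^ 2) (8 * (K.κef + K.κefs) / (A.η₁ * K.θfcd)) /
      (K.κeg + max (K.κJ ^ 2) (8 * (K.κef + K.κefs) / (A.η₁ * K.θfcd))))

def Consts.C₂ : ℝ := A.η₁ * A.η₂ * K.θfcd / 4 - 2 * K.εf

def Consts.C₃ (ζ : ℝ) : ℝ := 2 * (1 + K.ν / ζ)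

/-- The requirement on `η₂`. -/
def Consts.EtaCondition : Prop :=
  max (K.κJ ^ 2) (max (6 * (K.κef + K.κefs) / K.θfcd) (8 * K.εf / (A.η₁ * K.θfcd))) ≤ A.η₂

/-- The requirement on `ζ`. -/
def Consts.ZetaCondition (ζ : ℝ) : Prop :=
  K.κeg + max (K.κμg A) (max (8 * (K.κef + K.κefs) / (A.η₁ * K.θfcd)) (max (K.κJ ^ 2) A.η₂)) ≤ ζ

/-- The requirement on `τ`. -/
def Consts.TauCondition (ζ τ : ℝ) : Prop :=
  max ((A.lam ^ 2 - 1 / A.lam ^ 2) / (K.C₁ A * ζ))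
    (max ((A.lam ^ 2 - 1 / A.lam ^ 2) / K.C₂ A)
      ((A.lam ^ 2 - 1 / A.lam ^ 2) / ((K.κef + K.κefs) / 2))) < τ / (1 - τ)

/-- The requirements on the probabilities `p` and `q`.  The first one, a lower bound on
`(pq - 1/2) / ((1 - p)(1 - q))`, is written without the quotient, which is infinite if `p = 1`
or `q = 1`. -/
def Consts.ProbCondition (ζ τ p q : ℝ) : Prop :=
  1 / 2 < p * q ∧
  K.C₃ ζ / K.C₁ A * ((1 - p) * (1 - q)) ≤ p * q - 1 / 2 ∧
  (1 - p) * (1 - q) ≤ (1 - τ) * (1 - 1 / A.lam ^ 2) /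
    (2 * (τ * K.C₃ ζ * ζ + (1 - τ) * (A.lam ^ 2 - 1)))

/-- `σ = ¼ (1 - τ) (1 - 1/λ²)`. -/
def Params.sigma (τ : ℝ) : ℝ := 1 / 4 * (1 - τ) * (1 - 1 / A.lam ^ 2)

end Consts

end StochLM

end

noncomputable section

namespace StochLM

/-! ### The objective -/

/-! The proof is a drift argument. Write `c = ζ / ε` for the critical parameter value. The potential
`Φ` alone loses an amount of order `1 / μ²` per iteration on average, which is not bounded below as
`μ` grows. Therefore `w * Φ` is augmented by the level of `μ`, the number of factors `λ` by which
`μ` exceeds `c` (`augPhi`). With `w = p q c² / σ` the augmented potential loses at least `2 p q - 1`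
on average in each iteration before the gradient first falls to `ε`. It is nonnegative and starts at
`w * Φ₀`, because `μ₀` lies below `c`. Summing the drift over the decreasing events `notHit` bounds
the expected hitting time by `w * Φ₀ / (2 p q - 1)`.

Two estimates make up the drift. For `Φ` (`potentialChange_le`), multiplication by `μ²` removes the
parameter and leaves three cases. If the model or the function estimates are accurate, `Φ` drops by
at least `(1 - τ)(1 - λ⁻²) / μ²`. If both are, there is a further gain proportional to the excess of
`μ ‖∇f‖` over `ζ`. If neither is, the loss is affine in that excess. A tower argument without
independence (`integral_le_of_two_stage`) gives the both-accurate case weight at least `p q` and the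
neither case weight at most `(1 - p)(1 - q)`. The conditions on the probabilities then leave a mean
decrease of at least `σ / μ²` (`Consts.sigma_le`).

For the level (`level_next_le`), an iteration adds at most one. When everything is accurate and `μ >
c`, the gradient bound gives `μ ‖∇f‖ ≥ ζ`, the iteration succeeds and the level falls by one. When
everything is accurate and `μ ≤ c`, the level merely stays zero. The mean change is thus at most
`-(2 p q - 1)`, plus `p q` when `μ ≤ c`. In that range the decrease `w σ / μ² ≥ w σ / c² = p q` of
`w * Φ` pays the difference (`setIntegral_augPhi_succ_sub_le`). -/

theorem hasGradientAt_obj {n m : ℕ} {r : Vec n → Vec m} (hr : ContDiff ℝ 1 r) (x : Vec n) :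
    HasGradientAt (obj r) (jacTRes r x) x := by
  have h1 : HasFDerivAt r (fderiv ℝ r x) x :=
    (hr.differentiable one_ne_zero x).hasFDerivAt
  have h2 := (h1.norm_sq).const_mul (1 / 2 : ℝ)
  rw [hasGradientAt_iff_hasFDerivAt]
  refine h2.congr_fderiv ?_
  ext v
  simp [jacTRes, ContinuousLinearMap.adjoint_inner_left]

theorem gradient_obj {n m : ℕ} {r : Vec n → Vec m} (hr : ContDiff ℝ 1 r) :
    gradient (obj r) = jacTRes r :=
  funext fun x => (hasGradientAt_obj hr x).gradient

theorem continuous_jacTRes {n m : ℕ} {r : Vec n → Vec m} (hr : ContDiff ℝ 1 r) :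
    Continuous (jacTRes r) := by
  have h1 : Continuous (fderiv ℝ r) := hr.continuous_fderiv one_ne_zero
  exact ((ContinuousLinearMap.adjoint (𝕜 := ℝ) (E := Vec n) (F := Vec m)).continuous.comp
    h1).clm_apply hr.continuous

theorem continuous_obj {n m : ℕ} {r : Vec n → Vec m} (hr : ContDiff ℝ 1 r) :
    Continuous (obj r) :=
  continuous_const.mul (hr.continuous.norm.pow 2)

theorem obj_nonneg {n m : ℕ} (r : Vec n → Vec m) (x : Vec n) : 0 ≤ obj r x := by
  unfold obj; positivity

/-- The descent lemma on a segment. -/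
theorem le_add_inner_add_of_lipschitzOnWith_gradient {E : Type*} [NormedAddCommGroup E]
    [InnerProductSpace ℝ E] [CompleteSpace E] {f : E → ℝ} {G : E → E} {ν : ℝ≥0} {x s : E}
    (hf : ∀ y, HasGradientAt f (G y) y) (hG : LipschitzOnWith ν G (segment ℝ x (x + s))) :
    f (x + s) ≤ f x + inner ℝ (G x) s + ν / 2 * ‖s‖ ^ 2 := by
  -- `φ` is `f` along the segment minus its quadratic upper bound, up to a constant. The Lipschitz
  -- condition makes its derivative nonpositive, and `φ 1 ≤ φ 0` is the claim.
  let φ : ℝ → ℝ := fun t => f (x + t • s) - t * inner ℝ (G x) s - t ^ 2 * (ν / 2 * ‖s‖ ^ 2)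
  have hline : ∀ t : ℝ, HasDerivAt (fun t : ℝ => x + t • s) s t := fun t => by
    simpa using ((hasDerivAt_id t).smul_const s).const_add x
  have hφ : ∀ t, HasDerivAt φ (inner ℝ (G (x + t • s)) s - inner ℝ (G x) s
      - 2 * t * (ν / 2 * ‖s‖ ^ 2)) t := fun t => by
    have h1 := ((hf (x + t • s)).hasFDerivAt).comp_hasDerivAt t (hline t)
    have h2 := (hasDerivAt_id t).mul_const (inner ℝ (G x) s)
    have h3 := (hasDerivAt_pow 2 t).mul_const (ν / 2 * ‖s‖ ^ 2)
    refine ((h1.sub h2).sub h3).congr_deriv ?_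
    simp
  have hanti : AntitoneOn φ (Icc 0 1) := by
    refine antitoneOn_of_deriv_nonpos (convex_Icc 0 1)
      (fun t _ => (hφ t).continuousAt.continuousWithinAt)
      (fun t _ => (hφ t).differentiableAt.differentiableWithinAt) fun t ht => ?_
    rw [interior_Icc] at ht
    rw [(hφ t).deriv]
    have hx : x ∈ segment ℝ x (x + s) := left_mem_segment ℝ _ _
    have ht' : x + t • s ∈ segment ℝ x (x + s) := by
      rw [segment_eq_image']
      exact ⟨t, ⟨ht.1.le, ht.2.le⟩, by simp⟩
    have h1 := hG.norm_sub_le ht' hx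
    have h2 : inner ℝ (G (x + t • s) - G x) s ≤ ‖G (x + t • s) - G x‖ * ‖s‖ :=
      real_inner_le_norm _ _
    rw [inner_sub_left] at h2
    have h3 : ‖x + t • s - x‖ = t * ‖s‖ := by
      rw [add_sub_cancel_left, norm_smul, Real.norm_of_nonneg ht.1.le]
    rw [h3] at h1
    nlinarith [norm_nonneg s]
  have := hanti (left_mem_Icc.2 zero_le_one) (right_mem_Icc.2 zero_le_one) zero_le_one
  simp only [φ, one_smul, zero_smul, add_zero] at this
  linarith

/-! ### The constants -/

namespace Consts

variable (A : Params) (K : Consts)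

theorem κefs_pos : 0 < K.κefs := by
  have := K.κef_pos; have := K.κeg_pos; have := K.κJ_pos
  unfold κefs; positivity

/-- The sum `κef + κefs` is the single constant against which gradient error and curvature are
charged later. -/
theorem le_κef_add_κefs : K.κeg + K.ν / 2 + 2 * K.κJ ^ 2 ≤ K.κef + K.κefs := by
  have := K.κef_pos
  unfold κefs; linarith

theorem α_pos : 0 < K.α := by
  have := K.εf_pos; have := K.κeg_pos; have := K.κJ_pos; have := K.θin_pos; have := K.θfcd_pos
  unfold α; positivity

theorem C₁_pos : 0 < K.C₁ A := by
  have := A.η₁_pos; have := K.κeg_pos; have := K.θfcd_pos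
  have : 0 < max (K.κJ ^ 2) (8 * (K.κef + K.κefs) / (A.η₁ * K.θfcd)) :=
    lt_max_of_lt_left (pow_pos K.κJ_pos 2)
  unfold C₁; positivity

variable {A K}

theorem le_of_zetaCondition {ζ : ℝ} (hζ : K.ZetaCondition A ζ) :
    K.κμg A ≤ ζ - K.κeg ∧ 8 * (K.κef + K.κefs) / (A.η₁ * K.θfcd) ≤ ζ - K.κeg ∧
      K.κJ ^ 2 ≤ ζ - K.κeg ∧ A.η₂ ≤ ζ - K.κeg := by
  have h : max (K.κμg A) (max (8 * (K.κef + K.κefs) / (A.η₁ * K.θfcd))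
      (max (K.κJ ^ 2) A.η₂)) ≤ ζ - K.κeg := by
    unfold ZetaCondition at hζ; linarith
  simpa only [max_le_iff] using h

theorem zeta_pos {ζ : ℝ} (hζ : K.ZetaCondition A ζ) : 0 < ζ := by
  have := (le_of_zetaCondition hζ).2.2.2
  have := A.η₂_pos; have := K.κeg_pos
  linarith

theorem C₃_pos {ζ : ℝ} (hζ : K.ZetaCondition A ζ) : 0 < K.C₃ ζ := by
  have := zeta_pos hζ
  unfold C₃; positivity

/-- Beyond `κ_μg` the quadratic defining it is nonnegative. -/
theorem mul_add_le_of_κμg_le {a : ℝ} (ha : K.κμg A ≤ a) :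
    K.α * (a + K.κJ ^ 2) ≤ (1 - A.η₁) * a ^ 2 := by
  have h1 : 0 < 1 - A.η₁ := sub_pos.2 A.η₁_lt_one
  have h0 := K.α_pos
  have h2 : (K.α + √(K.α ^ 2 + 4 * K.α * K.κJ ^ 2 * (1 - A.η₁))) / (2 * (1 - A.η₁)) ≤ a :=
    (le_max_left _ _).trans ha
  rw [div_le_iff₀ (by positivity)] at h2
  have h3 : 0 ≤ K.α ^ 2 + 4 * K.α * K.κJ ^ 2 * (1 - A.η₁) := by positivity
  have h4 := Real.sq_sqrt h3
  have h5 := Real.sqrt_nonneg (K.α ^ 2 + 4 * K.α * K.κJ ^ 2 * (1 - A.η₁))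
  set y := √(K.α ^ 2 + 4 * K.α * K.κJ ^ 2 * (1 - A.η₁))
  have h6 : y ^ 2 ≤ (2 * (1 - A.η₁) * a - K.α) ^ 2 := by
    apply pow_le_pow_left₀ h5; linarith
  rw [h4] at h6
  -- Up to the factor `4 (1 - η₁)`, the quadratic is the difference of the two squares compared in
  -- `h6`.
  have h7 : 0 ≤ 4 * (1 - A.η₁) * ((1 - A.η₁) * a ^ 2 - K.α * (a + K.κJ ^ 2)) := by
    nlinarith
  have := nonneg_of_mul_nonneg_right h7 (by positivity)
  linarith

theorem le_of_etaCondition (h : K.EtaCondition A) :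
    K.κJ ^ 2 ≤ A.η₂ ∧ 6 * (K.κef + K.κefs) / K.θfcd ≤ A.η₂ ∧
      8 * K.εf / (A.η₁ * K.θfcd) ≤ A.η₂ := by
  simpa only [EtaCondition, max_le_iff] using h

/-- `C₁ A ≤ η₁ θ a / 8` when `a` is large and `|a - A| ≤ κ_eg`. -/
theorem C₁_mul_le {a x : ℝ} (h1 : K.κJ ^ 2 ≤ a)
    (h2 : 8 * (K.κef + K.κefs) / (A.η₁ * K.θfcd) ≤ a) (h3 : x ≤ a + K.κeg) :
    K.C₁ A * x ≤ A.η₁ * K.θfcd / 8 * a := by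
  have hη := A.η₁_pos; have hκ := K.κeg_pos; have hθ := K.θfcd_pos
  unfold C₁
  set B := max (K.κJ ^ 2) (8 * (K.κef + K.κefs) / (A.η₁ * K.θfcd))
  have hB : 0 < B := lt_max_of_lt_left (pow_pos K.κJ_pos 2)
  have hBa : B ≤ a := max_le h1 h2
  rw [mul_assoc]
  refine mul_le_mul_of_nonneg_left ?_ (by positivity)
  rw [div_mul_eq_mul_div, div_le_iff₀ (by positivity)]
  nlinarith

/-- A success can raise the `1 / μ²` part of the potential by `(1 - τ)(λ² - 1)` in rescaled units.
Since `λ² - λ⁻² = (λ² - 1) + (1 - λ⁻²)`, each of these bounds lets the decrease of `τ f` pay for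
that and still leave the `(1 - τ)(1 - λ⁻²)` gained by an unsuccessful iteration. -/
theorem le_mul_of_tauCondition {ζ τ : ℝ} (hζ : K.ZetaCondition A ζ) (hC₂ : 0 < K.C₂ A)
    (hτ : τ ∈ Ioo (0 : ℝ) 1) (h : K.TauCondition A ζ τ) :
    (1 - τ) * (A.lam ^ 2 - 1 / A.lam ^ 2) ≤ τ * (K.C₁ A * ζ) ∧
    (1 - τ) * (A.lam ^ 2 - 1 / A.lam ^ 2) ≤ τ * K.C₂ A ∧
    (1 - τ) * (A.lam ^ 2 - 1 / A.lam ^ 2) ≤ τ * ((K.κef + K.κefs) / 2) := by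
  have h1 := K.C₁_pos A; have h2 := zeta_pos hζ; have h3 := K.κef_pos; have h4 := K.κefs_pos
  have key : ∀ c : ℝ, 0 < c → (A.lam ^ 2 - 1 / A.lam ^ 2) / c < τ / (1 - τ) →
      (1 - τ) * (A.lam ^ 2 - 1 / A.lam ^ 2) ≤ τ * c := fun c hc hlt => by
    rw [div_lt_div_iff₀ hc (sub_pos.2 hτ.2)] at hlt
    linarith
  rw [TauCondition, max_lt_iff, max_lt_iff] at h
  exact ⟨key _ (by positivity) h.1, key _ hC₂ h.2.1, key _ (by positivity) h.2.2⟩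

end Consts

/-! ### One iteration, in quantities rescaled by the regularization parameter -/

/-- What is known about one iteration, in rescaled quantities: `a = μ ‖g‖`, `b = μ ‖∇f(x)‖`,
`ℓ = μ ‖s‖`, `D = μ² (m(x) - m(x + s))`, `e = μ² gᵀs`, `d = μ² ∇f(x)ᵀs` and
`h = μ² (f(x + s) - f(x))`. -/
structure ScaledStep (K : Consts) (a b ℓ D e d h : ℝ) : Prop where
  a_nonneg : 0 ≤ a
  b_nonneg : 0 ≤ b
  ℓ_nonneg : 0 ≤ ℓ
  ℓ_le : ℓ ≤ 2
  cauchy : K.θfcd / 2 * a ^ 2 ≤ D * (K.κJ ^ 2 + a)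
  D_le : D ≤ -e - a * ℓ ^ 2 / 2
  neg_e_le : -e ≤ a * ℓ
  inner_le : a * ℓ ^ 2 + e ≤ 4 * K.κJ ^ 2 + 2 * K.θin
  neg_inner_le : -(a * ℓ ^ 2 + e) ≤ 4 * K.κJ ^ 2 + 2 * K.θin
  h_le : h ≤ d + K.ν / 2 * ℓ ^ 2
  d_le : d ≤ b * ℓ

namespace ScaledStep

variable {A : Params} {K : Consts} {a b ℓ D e d h : ℝ}

/-- For `a ≥ κJ²` the Cauchy denominator is at most `2 a`, which makes the decrease linear in `a`.
-/
theorem le_D (S : ScaledStep K a b ℓ D e d h) (ha : K.κJ ^ 2 ≤ a) : K.θfcd / 4 * a ≤ D := by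
  have hJ := pow_pos K.κJ_pos 2
  have hθ := K.θfcd_pos
  have h0 : 0 < a := hJ.trans_le ha
  have hD : 0 ≤ D := by
    by_contra! hD
    have := S.cauchy
    have : D * (K.κJ ^ 2 + a) < 0 := mul_neg_of_neg_of_pos hD (by positivity)
    have : 0 ≤ K.θfcd / 2 * a ^ 2 := by positivity
    linarith
  have h1 := S.cauchy
  have h2 : D * (K.κJ ^ 2 + a) ≤ D * (2 * a) := by gcongr; linarith
  have h3 : K.θfcd / 4 * a * (2 * a) ≤ D * (2 * a) := by nlinarith
  exact le_of_mul_le_mul_right h3 (by positivity)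

/-- The model can fall by at most `a ℓ - a ℓ² / 2 ≤ a / 2`, while the Cauchy condition forces `θfcd
* a / 4`. -/
theorem θfcd_le_two (S : ScaledStep K a b ℓ D e d h) (ha : K.κJ ^ 2 ≤ a) : K.θfcd ≤ 2 := by
  have h0 : 0 < a := (pow_pos K.κJ_pos 2).trans_le ha
  have h1 := S.le_D ha
  have h2 := S.D_le
  have h3 := S.neg_e_le
  have h4 : K.θfcd / 4 * a ≤ 1 / 2 * a := by nlinarith [mul_nonneg h0.le (sq_nonneg (ℓ - 1))]
  have := le_of_mul_le_mul_right h4 h0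
  linarith

/-- A step computed from an accurate model decreases the objective. -/
theorem h_le_of_accurate (S : ScaledStep K a b ℓ D e d h) (ha : K.κJ ^ 2 ≤ a)
    (ha' : 6 * (K.κef + K.κefs) / K.θfcd ≤ a) (hd : d ≤ e + K.κeg * ℓ) :
    h ≤ -((K.κef + K.κefs) / 2) := by
  have hθ := K.θfcd_pos; have hκ := K.κeg_pos; have hν := K.ν.2
  have hQ := K.le_κef_add_κefs
  have h1 := S.le_D ha
  have h2 := S.θfcd_le_two ha
  have hJ := pow_pos K.κJ_pos 2
  rw [div_le_iff₀ hθ] at ha'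
  have h0 : 0 < a := hJ.trans_le ha
  have h3 : 3 * (K.κef + K.κefs) ≤ a := by nlinarith
  have h4 := S.D_le; have h5 := S.h_le
  -- The regularization term `a ℓ² / 2` absorbs the curvature `ν ℓ² / 2` and the gradient error `κeg
  -- ℓ` up to `κeg / 6`.
  have h6 : (3 * (K.κeg + K.ν / 2)) * ℓ ^ 2 ≤ a * ℓ ^ 2 := by
    gcongr; linarith
  have h7 : 0 ≤ (K.ν : ℝ) * ℓ ^ 2 := by positivity
  have h8 : K.κeg * ℓ - 3 / 2 * K.κeg * ℓ ^ 2 ≤ K.κeg / 6 := by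
    nlinarith [mul_nonneg hκ.le (sq_nonneg (3 * ℓ - 1))]
  nlinarith

/-- Here `a ≥ 4 (κef + κefs)`, so half of the regularization term suffices to absorb curvature and
gradient error up to `κeg / 4`. The other half is kept, since the acceptance test needs it. -/
theorem h_le_neg_of_large (S : ScaledStep K a b ℓ D e d h) (ha : K.κJ ^ 2 ≤ a)
    (hQa : 8 * (K.κef + K.κefs) / (A.η₁ * K.θfcd) ≤ a) (hd : d ≤ e + K.κeg * ℓ) :
    h ≤ -D - a * ℓ ^ 2 / 4 + K.κeg / 4 ∧ 8 * (K.κef + K.κefs) ≤ A.η₁ * K.θfcd * a := by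
  have hθ := K.θfcd_pos; have hη := A.η₁_pos; have hη' := A.η₁_lt_one
  have hκ := K.κeg_pos; have hν := K.ν.2
  have hQ := K.le_κef_add_κefs
  have h1 := S.le_D ha
  have h2 := S.θfcd_le_two ha
  have hJ := pow_pos K.κJ_pos 2
  rw [div_le_iff₀ (by positivity)] at hQa
  have h0 : 0 < a := hJ.trans_le ha
  refine ⟨?_, by linarith⟩
  have hηθ : A.η₁ * K.θfcd ≤ 2 := by nlinarith
  have h3 : 4 * (K.κef + K.κefs) ≤ a := by nlinarith
  have h4 := S.D_le; have h5 := S.h_le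
  have h6 : (4 * (K.κeg + K.ν / 2)) * ℓ ^ 2 ≤ a * ℓ ^ 2 := by
    gcongr; linarith
  have h7 : 0 ≤ (K.ν : ℝ) * ℓ ^ 2 := by positivity
  have h8 : K.κeg * ℓ - K.κeg * ℓ ^ 2 ≤ K.κeg / 4 := by
    nlinarith [mul_nonneg hκ.le (sq_nonneg (2 * ℓ - 1))]
  nlinarith

/-- If the gradient estimate is large, a step computed from an accurate model decreases the
objective in proportion to the gradient. -/
theorem h_le_neg_C₁_mul (S : ScaledStep K a b ℓ D e d h) (ha : K.κJ ^ 2 ≤ a)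
    (hQa : 8 * (K.κef + K.κefs) / (A.η₁ * K.θfcd) ≤ a) (hd : d ≤ e + K.κeg * ℓ)
    (hb : b ≤ a + K.κeg) : h ≤ -(K.C₁ A * b) := by
  obtain ⟨h1, h2⟩ := S.h_le_neg_of_large ha hQa hd
  have h3 := S.le_D ha
  have h4 := Consts.C₁_mul_le ha hQa hb
  have hθ := K.θfcd_pos; have hη' := A.η₁_lt_one
  have hQ := K.le_κef_add_κefs
  have h0 := S.a_nonneg; have hν := K.ν.2; have hJ := sq_nonneg K.κJ
  have h5 : 0 ≤ a * ℓ ^ 2 := by positivity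
  have h6 : A.η₁ * (K.θfcd * a) ≤ K.θfcd * a := mul_le_of_le_one_left (by positivity) hη'.le
  have hκ := K.κeg_pos
  have : (0:ℝ) ≤ K.ν := hν
  linarith

/-- If the gradient estimate is large, a step computed from an accurate model achieves the
fraction `η₁` of the model decrease, with a margin of `2 ε_f`. -/
theorem mul_add_le_neg_h (S : ScaledStep K a b ℓ D e d h) (ha : K.κJ ^ 2 ≤ a)
    (hQa : 8 * (K.κef + K.κefs) / (A.η₁ * K.θfcd) ≤ a) (hμg : K.κμg A ≤ a)
    (hεf : 8 * K.εf / (A.η₁ * K.θfcd) ≤ a)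
    (hd : d ≤ e + K.κeg * ℓ) : A.η₁ * D + 2 * K.εf ≤ -h := by
  obtain ⟨h1, h2⟩ := S.h_le_neg_of_large ha hQa hd
  have hη := A.η₁_pos; have hη' := A.η₁_lt_one; have hθ := K.θfcd_pos
  have hJ := pow_pos K.κJ_pos 2
  have h0 : 0 < a := hJ.trans_le ha
  have h3 := S.le_D ha
  have hα := Consts.mul_add_le_of_κμg_le hμg
  have h4 : K.θfcd / 2 * K.α ≤ (1 - A.η₁) * D := by
    have h5 : K.θfcd / 2 * K.α * (K.κJ ^ 2 + a) ≤ (1 - A.η₁) * D * (K.κJ ^ 2 + a) := by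
      have h6 := mul_le_mul_of_nonneg_left S.cauchy (sub_pos.2 hη').le
      have h7 := mul_le_mul_of_nonneg_left hα (half_pos hθ).le
      linarith
    exact le_of_mul_le_mul_right h5 (by positivity)
  have h5 : K.θfcd / 2 * K.α = K.εf + K.κeg + K.ν + 5 * K.κJ ^ 2 + 2 * K.θin := by
    unfold Consts.α; field_simp
  -- The constant `α` supplies only one of the two `εf` in the margin. The other comes from `2 εf ≤
  -- D` and `D ≤ a ℓ² / 2 + 4 κJ² + 2 θin`, through the retained term `a ℓ² / 4`.
  have h6 : 2 * K.εf ≤ D := by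
    rw [div_le_iff₀ (by positivity)] at hεf
    have h7 : A.η₁ * (K.θfcd * a) ≤ K.θfcd * a := mul_le_of_le_one_left (by positivity) hη'.le
    linarith
  have h7 := S.D_le; have h8 := S.inner_le; have h9 := S.neg_inner_le
  have hν : (0 : ℝ) ≤ K.ν := K.ν.2
  have := K.θin_pos; have := K.κeg_pos
  linarith

/-- A successful step with accurate estimates decreases the objective. -/
theorem h_le_neg_C₂ (S : ScaledStep K a b ℓ D e d h) (ha : K.κJ ^ 2 ≤ a) (ha' : A.η₂ ≤ a)
    (hh : A.η₁ * D ≤ -h + 2 * K.εf) : h ≤ -K.C₂ A := by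
  have h1 := S.le_D ha
  have hη := A.η₁_pos; have hθ := K.θfcd_pos
  have h2 : A.η₁ * (K.θfcd / 4 * A.η₂) ≤ A.η₁ * D := by
    gcongr; exact (mul_le_mul_of_nonneg_left ha' (by positivity)).trans h1
  unfold Consts.C₂
  linarith

/-- No accuracy is needed: `ℓ ≤ 2` gives `h ≤ 2 b + 2 ν`, and `ν` is rescaled by `max b ζ / ζ ≥ 1`.
This limits the damage when model and estimates are both wrong. -/
theorem h_le_C₃_mul (S : ScaledStep K a b ℓ D e d h) {ζ : ℝ} (hζ : 0 < ζ) :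
    h ≤ K.C₃ ζ * max b ζ := by
  have hν : (0 : ℝ) ≤ K.ν := K.ν.2
  have h1 := S.h_le; have h2 := S.d_le; have h3 := S.ℓ_le; have h4 := S.ℓ_nonneg
  have h5 := S.b_nonneg
  have h6 : (K.ν : ℝ) / 2 * ℓ ^ 2 ≤ 2 * K.ν := by
    have : ℓ ^ 2 ≤ 4 := by nlinarith
    nlinarith
  have h7 : b * ℓ ≤ 2 * max b ζ := by nlinarith [le_max_left b ζ]
  have h8 : (K.ν : ℝ) ≤ K.ν / ζ * max b ζ := by
    rw [div_mul_eq_mul_div, le_div_iff₀ hζ]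
    gcongr; exact le_max_right _ _
  unfold Consts.C₃
  linarith

end ScaledStep

/-! ### One iteration -/

section Step

variable {n m : ℕ} {r : Vec n → Vec m} {K : Consts} {A : Params} {D : IterData n m} {x : Vec n}
  {μ : ℝ}

theorem Model.decrease_eq (M : Model n m) (μ : ℝ) (s : Vec n) :
    M.decrease μ s = -inner ℝ M.grad s - 1 / 2 * ‖M.jac s‖ ^ 2
      - 1 / 2 * (μ * ‖M.grad‖ * ‖s‖ ^ 2) := by
  simp only [Model.decrease, Model.eval, inner_add_right, ContinuousLinearMap.adjoint_inner_right,
    inner_smul_right, real_inner_self_eq_norm_sq, Model.reg, map_zero, inner_zero_right, smul_zero]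
  ring

theorem scaledStep (hr : ContDiff ℝ 1 r) (hμ : 0 < μ)
    (hL : LipschitzOnWith K.ν (gradient (obj r)) (segment ℝ x (x + D.s)))
    (hJ : ‖D.M.jac‖ ≤ K.κJ)
    (hdec : K.θfcd / 2 * (‖D.M.grad‖ ^ 2 / (‖D.M.jac‖ ^ 2 + D.M.reg μ)) ≤ D.M.decrease μ D.s)
    (hs : ‖D.s‖ ≤ 2 / μ)
    (hin : |inner ℝ D.s (D.M.reg μ • D.s + D.M.grad)|
      ≤ (4 * ‖D.M.jac‖ ^ 2 + 2 * K.θin) / μ ^ 2) :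
    ScaledStep K (μ * ‖D.M.grad‖) (μ * ‖jacTRes r x‖) (μ * ‖D.s‖) (μ ^ 2 * D.M.decrease μ D.s)
      (μ ^ 2 * inner ℝ D.M.grad D.s) (μ ^ 2 * inner ℝ (jacTRes r x) D.s)
      (μ ^ 2 * (obj r (x + D.s) - obj r x)) := by
  have hθ := K.θfcd_pos
  have hJ2 : ‖D.M.jac‖ ^ 2 ≤ K.κJ ^ 2 := pow_le_pow_left₀ (norm_nonneg _) hJ 2
  have hμ2 : 0 < μ ^ 2 := by positivity
  have hin' : |inner ℝ D.s (D.M.reg μ • D.s + D.M.grad)| * μ ^ 2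
      ≤ 4 * K.κJ ^ 2 + 2 * K.θin := by
    rw [le_div_iff₀ hμ2] at hin; linarith
  have heq : inner ℝ D.s (D.M.reg μ • D.s + D.M.grad) * μ ^ 2 =
      μ * ‖D.M.grad‖ * (μ * ‖D.s‖) ^ 2 + μ ^ 2 * inner ℝ D.M.grad D.s := by
    rw [inner_add_right, inner_smul_right, real_inner_self_eq_norm_sq, Model.reg,
      real_inner_comm]
    ring
  rw [← abs_of_pos hμ2, ← abs_mul, heq] at hin'
  have hdec0 : 0 ≤ D.M.decrease μ D.s :=
    le_trans (by rw [Model.reg]; positivity) hdec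
  refine
    { a_nonneg := by positivity
      b_nonneg := by positivity
      ℓ_nonneg := by positivity
      ℓ_le := by rwa [le_div_iff₀ hμ, mul_comm] at hs
      cauchy := ?_
      D_le := ?_
      neg_e_le := ?_
      inner_le := (le_abs_self _).trans hin'
      neg_inner_le := (neg_le_abs _).trans hin'
      h_le := ?_
      d_le := ?_ }
  -- For a zero gradient estimate the denominator may vanish, but then nonnegativity of the decrease
  -- is all that is required.
  · rcases eq_or_lt_of_le (norm_nonneg D.M.grad) with hg | hg
    · rw [← hg, mul_zero, zero_pow two_ne_zero, mul_zero, add_zero]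
      positivity
    · have hpos : 0 < ‖D.M.jac‖ ^ 2 + D.M.reg μ := by rw [Model.reg]; positivity
      have h1 : K.θfcd / 2 * ‖D.M.grad‖ ^ 2 ≤
          D.M.decrease μ D.s * (‖D.M.jac‖ ^ 2 + D.M.reg μ) := by
        rwa [← mul_div_assoc, div_le_iff₀ hpos] at hdec
      have h2 : D.M.decrease μ D.s * (‖D.M.jac‖ ^ 2 + D.M.reg μ) ≤
          D.M.decrease μ D.s * (K.κJ ^ 2 + μ * ‖D.M.grad‖) := by
        rw [Model.reg]; gcongr
      have h3 := mul_le_mul_of_nonneg_left (h1.trans h2) hμ2.le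
      linarith
  · rw [Model.decrease_eq]
    have : 0 ≤ μ ^ 2 * ‖D.M.jac D.s‖ ^ 2 := by positivity
    linarith
  · have := mul_le_mul_of_nonneg_left (neg_le_of_abs_le (abs_real_inner_le_norm D.M.grad D.s))
      hμ2.le
    linarith
  · have h := le_add_inner_add_of_lipschitzOnWith_gradient (hasGradientAt_obj hr)
      (gradient_obj hr ▸ hL)
    have := mul_le_mul_of_nonneg_left h hμ2.le
    linarith
  · have := mul_le_mul_of_nonneg_left (real_inner_le_norm (jacTRes r x) D.s) hμ2.le
    linarith

/-- The gradient estimate of the model is accurate at an iterate. -/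
def ModelAcc (r : Vec n → Vec m) (K : Consts) (D : IterData n m) (x : Vec n) (μ : ℝ) : Prop :=
  ‖D.M.grad - jacTRes r x‖ ≤ K.κeg / μ

/-- The function estimates are accurate at an iterate. -/
def EstAcc (r : Vec n → Vec m) (K : Consts) (D : IterData n m) (x : Vec n) (μ : ℝ) : Prop :=
  |D.f0 - obj r x| ≤ K.εf / μ ^ 2 ∧ |D.f1 - obj r (x + D.s)| ≤ K.εf / μ ^ 2

theorem ModelAcc.scaled (h : ModelAcc r K D x μ) (hμ : 0 < μ) :
    μ * ‖jacTRes r x‖ ≤ μ * ‖D.M.grad‖ + K.κeg ∧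
    μ ^ 2 * inner ℝ (jacTRes r x) D.s ≤
      μ ^ 2 * inner ℝ D.M.grad D.s + K.κeg * (μ * ‖D.s‖) := by
  unfold ModelAcc at h
  rw [le_div_iff₀ hμ] at h
  have h1 : ‖jacTRes r x‖ - ‖D.M.grad‖ ≤ ‖D.M.grad - jacTRes r x‖ := by
    rw [norm_sub_rev]; exact norm_sub_norm_le _ _
  have h2 := real_inner_le_norm (jacTRes r x - D.M.grad) D.s
  rw [inner_sub_left, norm_sub_rev] at h2
  constructor
  · have := mul_le_mul_of_nonneg_right h1 hμ.le
    linarith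
  · have h3 := mul_le_mul_of_nonneg_left h2 (sq_nonneg μ)
    have h4 := mul_le_mul_of_nonneg_right h (mul_nonneg hμ.le (norm_nonneg D.s))
    linarith

theorem EstAcc.scaled (h : EstAcc r K D x μ) (hμ : 0 < μ) :
    |μ ^ 2 * (D.f0 - D.f1) + μ ^ 2 * (obj r (x + D.s) - obj r x)| ≤ 2 * K.εf := by
  obtain ⟨h0, h1⟩ := h
  have hμ2 : 0 < μ ^ 2 := by positivity
  rw [le_div_iff₀ hμ2, ← abs_of_pos hμ2, ← abs_mul, abs_le] at h0 h1
  rw [abs_le]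
  constructor <;> linarith [h0.1, h0.2, h1.1, h1.2]

/-- The sufficient decrease of a successful iteration, rescaled. -/
theorem Successful.scaled (h : Successful A D μ) (hμ : 0 < μ)
    (hD : 0 ≤ D.M.decrease μ D.s) :
    A.η₂ ≤ μ * ‖D.M.grad‖ ∧
      A.η₁ * (μ ^ 2 * D.M.decrease μ D.s) ≤ μ ^ 2 * (D.f0 - D.f1) := by
  obtain ⟨h1, h2⟩ := h
  have hη := A.η₁_pos
  constructor
  · rwa [div_le_iff₀ hμ, mul_comm] at h2
  -- With zero model decrease the ratio is `0` by the division convention, hence below `η₁`.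
  · rcases hD.eq_or_lt with hD | hD
    · rw [ratio, ← hD, div_zero] at h1
      exact absurd h1 (not_le.2 hη)
    · rw [ratio, le_div_iff₀ hD] at h1
      have := mul_le_mul_of_nonneg_left h1 (sq_nonneg μ)
      linarith

/-- From `b ≥ ζ` and gradient accuracy, `a ≥ ζ - κeg` exceeds every threshold in the condition on
`ζ`. The true decrease then beats `η₁ D` by `2 εf`, exactly the possible error of the estimated
decrease. -/
theorem successful_of_accurate {a b ℓ e d h ζ : ℝ} (hμ : 0 < μ)
    (S : ScaledStep K a b ℓ (μ ^ 2 * D.M.decrease μ D.s) e d h)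
    (ha : a = μ * ‖D.M.grad‖) (hh : h = μ ^ 2 * (obj r (x + D.s) - obj r x))
    (hη₂ : K.EtaCondition A) (hζ : K.ZetaCondition A ζ) (hb : b ≤ a + K.κeg)
    (hd : d ≤ e + K.κeg * ℓ) (hV : EstAcc r K D x μ) (hζb : ζ ≤ b) : Successful A D μ := by
  obtain ⟨hζ1, hζ2, hζ3, hζ4⟩ := Consts.le_of_zetaCondition hζ
  have hη := A.η₁_pos; have hθ := K.θfcd_pos; have hη₂' := A.η₂_pos
  have ha' : ζ - K.κeg ≤ a := by linarith
  have h1 := S.mul_add_le_neg_h (hζ3.trans ha') (hζ2.trans ha') (hζ1.trans ha')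
    ((Consts.le_of_etaCondition hη₂).2.2.trans (hζ4.trans ha')) hd
  have h2 := S.le_D (hζ3.trans ha')
  have h3 : 0 < a := hη₂'.trans_le (hζ4.trans ha')
  have hμ2 : 0 < μ ^ 2 := by positivity
  have h4 : 0 < D.M.decrease μ D.s :=
    pos_of_mul_pos_right ((by positivity : (0 : ℝ) < K.θfcd / 4 * a).trans_le h2) hμ2.le
  have h5 := (abs_le.1 (hV.scaled hμ)).1
  constructor
  · rw [ratio, le_div_iff₀ h4]
    refine le_of_mul_le_mul_left ?_ hμ2
    rw [← hh] at h5
    linarith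
  · rw [div_le_iff₀ hμ, mul_comm, ← ha]
    exact hζ4.trans ha'

open Classical in
/-- One step of the algorithm. -/
def next (A : Params) (D : IterData n m) (x : Vec n) (μ : ℝ) : Vec n × ℝ :=
  if Successful A D μ then (x + D.s, max (μ / A.lam) A.μmin) else (x, A.lam * μ)

/-- The change of the potential `τ f(x) + (1 - τ) / μ²` in one step. -/
def potentialChange (r : Vec n → Vec m) (A : Params) (τ : ℝ) (D : IterData n m) (x : Vec n)
    (μ : ℝ) : ℝ :=
  (τ * obj r (next A D x μ).1 + (1 - τ) / (next A D x μ).2 ^ 2) -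
    (τ * obj r x + (1 - τ) / μ ^ 2)

theorem potentialChange_of_not_successful {τ : ℝ} (hμ : 0 < μ) (h : ¬ Successful A D μ) :
    μ ^ 2 * potentialChange r A τ D x μ = -((1 - τ) * (1 - 1 / A.lam ^ 2)) := by
  have hl : 0 < A.lam := zero_lt_one.trans A.one_lt_lam
  simp only [potentialChange, next, if_neg h]
  field_simp
  ring

theorem potentialChange_of_successful {τ : ℝ} (hμ : 0 < μ) (hτ : τ ≤ 1)
    (h : Successful A D μ) :
    μ ^ 2 * potentialChange r A τ D x μ ≤
      τ * (μ ^ 2 * (obj r (x + D.s) - obj r x)) + (1 - τ) * (A.lam ^ 2 - 1) := by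
  have hl : 0 < A.lam := zero_lt_one.trans A.one_lt_lam
  simp only [potentialChange, next, if_pos h]
  have h1 : 0 < μ / A.lam := by positivity
  have h2 : (1 - τ) / max (μ / A.lam) A.μmin ^ 2 ≤ (1 - τ) / (μ / A.lam) ^ 2 := by
    have := sub_nonneg.2 hτ
    gcongr
    exact le_max_left _ _
  have h3 : μ ^ 2 * ((1 - τ) / (μ / A.lam) ^ 2) = (1 - τ) * A.lam ^ 2 := by
    field_simp
  have h4 : μ ^ 2 * ((1 - τ) / μ ^ 2) = 1 - τ := by
    field_simp
  have h5 := mul_le_mul_of_nonneg_left h2 (sq_nonneg μ)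
  rw [h3] at h5
  linarith

/-- Bounds for the change of the potential, according to whether the model and the function
estimates are accurate. -/
theorem potentialChange_le {b ℓ e d ζ τ : ℝ} (hμ : 0 < μ)
    (hD : 0 ≤ D.M.decrease μ D.s)
    (S : ScaledStep K (μ * ‖D.M.grad‖) b ℓ (μ ^ 2 * D.M.decrease μ D.s) e d
      (μ ^ 2 * (obj r (x + D.s) - obj r x)))
    (hη₂ : K.EtaCondition A) (hC₂ : 0 < K.C₂ A) (hζ : K.ZetaCondition A ζ)
    (hτ : τ ∈ Ioo (0 : ℝ) 1) (hτ' : K.TauCondition A ζ τ)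
    {U : Prop} (hU : U → b ≤ μ * ‖D.M.grad‖ + K.κeg ∧ d ≤ e + K.κeg * ℓ)
    {V : Prop} (hV : V → EstAcc r K D x μ) :
    (U ∧ V → μ ^ 2 * potentialChange r A τ D x μ ≤
      -((1 - τ) * (1 - 1 / A.lam ^ 2)) - τ * (K.C₁ A * max (b - ζ) 0)) ∧
    (U ∨ V → μ ^ 2 * potentialChange r A τ D x μ ≤ -((1 - τ) * (1 - 1 / A.lam ^ 2))) ∧
    μ ^ 2 * potentialChange r A τ D x μ ≤
      τ * (K.C₃ ζ * (ζ + max (b - ζ) 0)) + (1 - τ) * (A.lam ^ 2 - 1) := by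
  obtain ⟨hζ1, hζ2, hζ3, hζ4⟩ := Consts.le_of_zetaCondition hζ
  obtain ⟨hE1, hE2, hE3⟩ := Consts.le_of_etaCondition hη₂
  obtain ⟨hT1, hT2, hT3⟩ := Consts.le_mul_of_tauCondition hζ hC₂ hτ hτ'
  have hτ0 := hτ.1
  have hw : 0 ≤ (1 - τ) * (A.lam ^ 2 - 1) :=
    mul_nonneg (sub_nonneg.2 hτ.2.le) (sub_nonneg.2 (one_le_pow₀ A.one_lt_lam.le))
  have hu : 0 ≤ (1 - τ) * (1 - 1 / A.lam ^ 2) :=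
    mul_nonneg (sub_nonneg.2 hτ.2.le) (sub_nonneg.2 (by
      rw [div_le_one (by have := A.one_lt_lam; positivity)]; exact one_le_pow₀ A.one_lt_lam.le))
  have hC₃ := Consts.C₃_pos hζ
  have hζ0 := Consts.zeta_pos hζ
  have hmax : ζ + max (b - ζ) 0 = max b ζ := by
    rw [← max_add_add_left]; simp
  have hUV : U ∨ V → μ ^ 2 * potentialChange r A τ D x μ ≤
      -((1 - τ) * (1 - 1 / A.lam ^ 2)) := by
    intro h
    by_cases hs : Successful A D μ
    · obtain ⟨hs1, hs2⟩ := hs.scaled hμ hD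
      have h1 := potentialChange_of_successful (r := r) (x := x) hμ hτ.2.le hs
      rcases h with h | h
      · have h2 := S.h_le_of_accurate (hE1.trans hs1) (hE2.trans hs1) (hU h).2
        have h3 := mul_le_mul_of_nonneg_left h2 hτ0.le
        linarith
      · have h2 := S.h_le_neg_C₂ (A := A) (hE1.trans hs1) hs1
          (by have := (abs_le.1 ((hV h).scaled hμ)).2; linarith)
        have h3 := mul_le_mul_of_nonneg_left h2 hτ0.le
        linarith
    · exact (potentialChange_of_not_successful hμ hs).le
  refine ⟨fun ⟨hu1, hv1⟩ => ?_, hUV, ?_⟩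
  -- Below `ζ` the excess vanishes and success is not needed. Above it success is forced, and `C₁ b`
  -- splits into `C₁ ζ`, which pays for the change of `μ`, and the extra gain.
  · rcases le_total b ζ with hb | hb
    · rw [max_eq_right (sub_nonpos.2 hb), mul_zero, mul_zero, sub_zero]
      exact hUV (Or.inl hu1)
    · obtain ⟨hU1, hU2⟩ := hU hu1
      have hs := successful_of_accurate hμ S rfl rfl hη₂ hζ hU1 hU2 (hV hv1) hb
      have h1 := potentialChange_of_successful (r := r) (x := x) hμ hτ.2.le hs
      have ha' : ζ - K.κeg ≤ μ * ‖D.M.grad‖ := by linarith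
      have h2 := S.h_le_neg_C₁_mul (hζ3.trans ha') (hζ2.trans ha') hU2 hU1
      have h3 := mul_le_mul_of_nonneg_left h2 hτ0.le
      rw [max_eq_left (sub_nonneg.2 hb)]
      linarith
  · have h0 : 0 ≤ τ * (K.C₃ ζ * (ζ + max (b - ζ) 0)) := by
      have := le_max_right (b - ζ) 0
      positivity
    by_cases hs : Successful A D μ
    · have h1 := potentialChange_of_successful (r := r) (x := x) hμ hτ.2.le hs
      have h2 := mul_le_mul_of_nonneg_left (S.h_le_C₃_mul hζ0) hτ0.le
      rw [hmax]
      linarith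
    · rw [potentialChange_of_not_successful hμ hs]
      linarith

end Step

/-! ### Conditional probability bounds tested against measurable weights -/

section Conditional

variable {Ω : Type*} {mΩ : MeasurableSpace Ω} {P : Measure Ω}

theorem integrable_of_nonneg_of_le [IsProbabilityMeasure P] {c : Ω → ℝ} (hc : Measurable c) (h0 : ∀ ω, 0 ≤ c ω)
    {C : ℝ} (hC : ∀ ω, c ω ≤ C) : Integrable c P :=
  Integrable.of_bound hc.aestronglyMeasurable C
    (Filter.Eventually.of_forall fun ω => by rw [Real.norm_of_nonneg (h0 ω)]; exact hC ω)

theorem integrable_mul_indicator_one {c : Ω → ℝ} (hc : Integrable c P) {B : Set Ω}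
    (hB : MeasurableSet B) : Integrable (fun ω => c ω * B.indicator (fun _ => (1 : ℝ)) ω) P := by
  have : (fun ω => c ω * B.indicator (fun _ => (1 : ℝ)) ω) = B.indicator c := by
    ext ω; by_cases h : ω ∈ B <;> simp [h]
  rw [this]; exact hc.indicator hB

theorem integral_sub_add {f g h : Ω → ℝ} (hf : Integrable f P) (hg : Integrable g P)
    (hh : Integrable h P) :
    ∫ ω, (f ω - g ω + h ω) ∂P = ∫ ω, f ω ∂P - ∫ ω, g ω ∂P + ∫ ω, h ω ∂P := by
  rw [← integral_sub hf hg]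
  exact integral_add (hf.sub hg) hh

variable [IsProbabilityMeasure P]

/-- The weight is `H`-measurable, so it can be pulled out of the conditional expectation before
integrating. -/
theorem mul_integral_le_of_le_condExp {H : MeasurableSpace Ω} (hH : H ≤ mΩ) {c : Ω → ℝ}
    (hc : Measurable[H] c) (h0 : ∀ ω, 0 ≤ c ω) (hint : Integrable c P) {B : Set Ω}
    (hB : MeasurableSet[mΩ] B) {p : ℝ}
    (hp : ∀ᵐ ω ∂P, p ≤ (P[B.indicator (fun _ => (1 : ℝ)) | H]) ω) :
    p * ∫ ω, c ω ∂P ≤ ∫ ω, c ω * B.indicator (fun _ => (1 : ℝ)) ω ∂P := by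
  have hBint : Integrable (B.indicator (fun _ => (1 : ℝ))) P :=
    (integrable_const 1).indicator hB
  have hcB := integrable_mul_indicator_one hint hB
  have h1 : P[fun ω => c ω * B.indicator (fun _ => (1 : ℝ)) ω | H] =ᵐ[P]
      fun ω => c ω * (P[B.indicator (fun _ => (1 : ℝ)) | H]) ω :=
    condExp_mul_of_stronglyMeasurable_left hc.stronglyMeasurable hcB hBint
  rw [← integral_condExp hH (f := fun ω => c ω * B.indicator (fun _ => (1 : ℝ)) ω),
    ← integral_const_mul]
  refine integral_mono_ae (hint.const_mul p) integrable_condExp ?_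
  filter_upwards [h1, hp] with ω hω hpω
  rw [hω, mul_comm]
  exact mul_le_mul_of_nonneg_left hpω (h0 ω)

theorem integral_mul_compl_le_of_le_condExp {H : MeasurableSpace Ω} (hH : H ≤ mΩ) {c : Ω → ℝ}
    (hc : Measurable[H] c) (h0 : ∀ ω, 0 ≤ c ω) (hint : Integrable c P) {B : Set Ω}
    (hB : MeasurableSet[mΩ] B) {p : ℝ}
    (hp : ∀ᵐ ω ∂P, p ≤ (P[B.indicator (fun _ => (1 : ℝ)) | H]) ω) :
    ∫ ω, c ω * Bᶜ.indicator (fun _ => (1 : ℝ)) ω ∂P ≤ (1 - p) * ∫ ω, c ω ∂P := by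
  have h1 := mul_integral_le_of_le_condExp hH hc h0 hint hB hp
  have h2 : ∫ ω, c ω * Bᶜ.indicator (fun _ => (1 : ℝ)) ω ∂P =
      ∫ ω, c ω ∂P - ∫ ω, c ω * B.indicator (fun _ => (1 : ℝ)) ω ∂P := by
    rw [← integral_sub hint (integrable_mul_indicator_one hint hB)]
    refine integral_congr_ae (Filter.Eventually.of_forall fun ω => ?_)
    by_cases h : ω ∈ B <;> simp [h]
  linarith

/-- If `U` has conditional probability at least `p` given `H`, and `V` has conditional probability
at least `q` given a larger `σ`-algebra that contains `U`, then a random variable that is bounded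
in terms of `H`-measurable weights on `U ∩ V` and `Uᶜ ∩ Vᶜ` is bounded on average. -/
theorem integral_le_of_two_stage {H H' : MeasurableSpace Ω} (hH : H ≤ H') (hH' : H' ≤ mΩ)
    {U V : Set Ω} (hU : MeasurableSet[H'] U) (hV : MeasurableSet[mΩ] V) {p q : ℝ}
    (hq0 : 0 ≤ q) (hq1 : q ≤ 1)
    (hp : ∀ᵐ ω ∂P, p ≤ (P[U.indicator (fun _ => (1 : ℝ)) | H]) ω)
    (hq : ∀ᵐ ω ∂P, q ≤ (P[V.indicator (fun _ => (1 : ℝ)) | H']) ω)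
    {Y c₀ c₁ c₂ : Ω → ℝ} (hY : Integrable Y P) (hc₀ : Integrable c₀ P)
    (hc₁ : Measurable[H] c₁) (hc₁0 : ∀ ω, 0 ≤ c₁ ω) (hc₁i : Integrable c₁ P)
    (hc₂ : Measurable[H] c₂) (hc₂0 : ∀ ω, 0 ≤ c₂ ω) (hc₂i : Integrable c₂ P)
    (hle : ∀ ω, Y ω ≤ c₀ ω - c₁ ω * (U ∩ V).indicator (fun _ => 1) ω
      + c₂ ω * (Uᶜ ∩ Vᶜ).indicator (fun _ => 1) ω) :
    ∫ ω, Y ω ∂P ≤ ∫ ω, (c₀ ω - p * q * c₁ ω + (1 - p) * (1 - q) * c₂ ω) ∂P := by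
  have hU' := hH' U hU
  have hHm := hH.trans hH'
  have hind : Measurable[H'] (U.indicator (fun _ => (1 : ℝ))) := measurable_const.indicator hU
  have hindc : Measurable[H'] (Uᶜ.indicator (fun _ => (1 : ℝ))) :=
    measurable_const.indicator hU.compl
  have hnn : ∀ (B : Set Ω) ω, 0 ≤ B.indicator (fun _ => (1 : ℝ)) ω := fun B ω =>
    indicator_nonneg (fun _ _ => zero_le_one) ω
  have h1 : p * q * ∫ ω, c₁ ω ∂P ≤
      ∫ ω, c₁ ω * (U ∩ V).indicator (fun _ => 1) ω ∂P := by
    -- The weight `c₁` is tested against `U` first. Then `c₁ * 1_U`, which is measurable for the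
    -- larger `σ`-algebra, is tested against `V`.
    have ha := mul_integral_le_of_le_condExp hHm hc₁ hc₁0 hc₁i hU' hp
    have hb := mul_integral_le_of_le_condExp hH' ((hc₁.mono hH le_rfl).mul hind)
      (fun ω => mul_nonneg (hc₁0 ω) (hnn U ω)) (integrable_mul_indicator_one hc₁i hU') hV hq
    have hc : ∫ ω, c₁ ω * (U ∩ V).indicator (fun _ => 1) ω ∂P =
        ∫ ω, c₁ ω * U.indicator (fun _ => 1) ω * V.indicator (fun _ => 1) ω ∂P := by
      simp only [mul_assoc, ← inter_indicator_mul, mul_one]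
    simp only [Pi.mul_apply] at hb
    rw [hc]
    refine le_trans ?_ hb
    have := mul_le_mul_of_nonneg_left ha hq0
    linarith
  have h2 : ∫ ω, c₂ ω * (Uᶜ ∩ Vᶜ).indicator (fun _ => 1) ω ∂P ≤
      (1 - p) * (1 - q) * ∫ ω, c₂ ω ∂P := by
    have ha := integral_mul_compl_le_of_le_condExp hHm hc₂ hc₂0 hc₂i hU' hp
    have hb := integral_mul_compl_le_of_le_condExp hH' ((hc₂.mono hH le_rfl).mul hindc)
      (fun ω => mul_nonneg (hc₂0 ω) (hnn Uᶜ ω))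
      (integrable_mul_indicator_one hc₂i hU'.compl) hV hq
    have hc : ∫ ω, c₂ ω * (Uᶜ ∩ Vᶜ).indicator (fun _ => 1) ω ∂P =
        ∫ ω, c₂ ω * Uᶜ.indicator (fun _ => 1) ω * Vᶜ.indicator (fun _ => 1) ω ∂P := by
      simp only [mul_assoc, ← inter_indicator_mul, mul_one]
    simp only [Pi.mul_apply] at hb
    rw [hc]
    refine hb.trans ?_
    have := mul_le_mul_of_nonneg_left ha (sub_nonneg.2 hq1)
    linarith
  have hi1 := integrable_mul_indicator_one hc₁i (hU'.inter hV)
  have hi2 := integrable_mul_indicator_one hc₂i (hU'.compl.inter hV.compl)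
  calc ∫ ω, Y ω ∂P
      ≤ ∫ ω, (c₀ ω - c₁ ω * (U ∩ V).indicator (fun _ => 1) ω
          + c₂ ω * (Uᶜ ∩ Vᶜ).indicator (fun _ => 1) ω) ∂P :=
        integral_mono hY ((hc₀.sub hi1).add hi2) hle
    _ = ∫ ω, c₀ ω ∂P - ∫ ω, c₁ ω * (U ∩ V).indicator (fun _ => 1) ω ∂P
          + ∫ ω, c₂ ω * (Uᶜ ∩ Vᶜ).indicator (fun _ => 1) ω ∂P :=
        integral_sub_add hc₀ hi1 hi2
    _ ≤ ∫ ω, c₀ ω ∂P - p * q * ∫ ω, c₁ ω ∂P + (1 - p) * (1 - q) * ∫ ω, c₂ ω ∂P := by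
        linarith
    _ = _ := by
        rw [integral_sub_add hc₀ (hc₁i.const_mul _) (hc₂i.const_mul _), integral_const_mul,
          integral_const_mul]

end Conditional

/-! ### The iterates as a stochastic process -/

namespace Run

variable {Ω : Type*} [MeasurableSpace Ω] {n m : ℕ} (R : Run Ω n m)

/-- The quantities computed at iteration `j`. -/
def data (j : ℕ) (ω : Ω) : IterData n m := ⟨R.M j ω, R.S j ω, R.F0 j ω, R.F1 j ω⟩

theorem state_succ (j : ℕ) (ω : Ω) :
    (R.X (j + 1) ω, R.mu (j + 1) ω) = next R.A (R.data j ω) (R.X j ω) (R.mu j ω) := by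
  rw [X, mu, Prod.mk.eta]
  rfl

theorem X_zero (ω : Ω) : R.X 0 ω = R.x₀ := rfl

theorem mu_zero (ω : Ω) : R.mu 0 ω = R.μ₀ := rfl

theorem X_succ (j : ℕ) (ω : Ω) :
    R.X (j + 1) ω = (next R.A (R.data j ω) (R.X j ω) (R.mu j ω)).1 :=
  congrArg Prod.fst (R.state_succ j ω)

theorem mu_succ (j : ℕ) (ω : Ω) :
    R.mu (j + 1) ω = (next R.A (R.data j ω) (R.X j ω) (R.mu j ω)).2 :=
  congrArg Prod.snd (R.state_succ j ω)

theorem μmin_le_mu (j : ℕ) (ω : Ω) : R.A.μmin ≤ R.mu j ω := by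
  induction j with
  | zero => exact R.μmin_le
  | succ j ih =>
    rw [mu_succ, next]
    split_ifs
    · exact le_max_right _ _
    · have := R.A.μmin_pos
      exact ih.trans (le_mul_of_one_le_left (by linarith) R.A.one_lt_lam.le)

theorem mu_pos (j : ℕ) (ω : Ω) : 0 < R.mu j ω := R.A.μmin_pos.trans_le (R.μmin_le_mu j ω)

theorem mu_le (j : ℕ) (ω : Ω) : R.mu j ω ≤ R.μ₀ * R.A.lam ^ j := by
  have hl := R.A.one_lt_lam
  have h0 := R.A.μmin_pos.trans_le R.μmin_le
  induction j with
  | zero => simp [mu_zero]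
  | succ j ih =>
    have h1 := R.mu_pos j ω
    have h2 : R.mu (j + 1) ω ≤ R.A.lam * R.mu j ω := by
      rw [mu_succ, next]
      split_ifs
      · refine max_le ?_ ?_
        · exact (div_le_self h1.le hl.le).trans (le_mul_of_one_le_left h1.le hl.le)
        · exact (R.μmin_le_mu j ω).trans (le_mul_of_one_le_left h1.le hl.le)
      · exact le_rfl
    rw [pow_succ]
    nlinarith

theorem norm_X_sub_le (hs : ∀ j ω, ‖R.S j ω‖ ≤ 2 / R.mu j ω) (j : ℕ) (ω : Ω) :
    ‖R.X j ω - R.x₀‖ ≤ j * (2 / R.A.μmin) := by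
  have h0 := R.A.μmin_pos
  induction j with
  | zero => simp [X_zero]
  | succ j ih =>
    have h1 : ‖R.X (j + 1) ω - R.X j ω‖ ≤ 2 / R.A.μmin := by
      rw [X_succ, next]
      split_ifs
      · rw [add_sub_cancel_left]
        refine (hs j ω).trans ?_
        have := R.μmin_le_mu j ω
        gcongr
      · rw [sub_self, norm_zero]; positivity
    have h2 := norm_sub_le_norm_sub_add_norm_sub (R.X (j + 1) ω) (R.X j ω) R.x₀
    push_cast
    linarith

/-! #### Measurability -/

theorem history_mono {j k : ℕ} (h : j ≤ k) :
    history R.M R.F0 R.F1 j ≤ history R.M R.F0 R.F1 k :=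
  biSup_mono fun _ hi => lt_of_lt_of_le hi h

theorem history_le (j : ℕ) : history R.M R.F0 R.F1 j ≤ ‹MeasurableSpace Ω› :=
  iSup₂_le fun i _ => sup_le (R.measurable_M i).comap_le
    (sup_le (R.measurable_F0 i).comap_le (R.measurable_F1 i).comap_le)

theorem halfHistory_le (j : ℕ) : halfHistory R.M R.F0 R.F1 j ≤ ‹MeasurableSpace Ω› :=
  sup_le (R.history_le j) (R.measurable_M j).comap_le

theorem history_le_halfHistory (j : ℕ) :
    history R.M R.F0 R.F1 j ≤ halfHistory R.M R.F0 R.F1 j := le_sup_left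

theorem comap_le_history_succ (j : ℕ) :
    MeasurableSpace.comap (R.M j) inferInstance ⊔
      (MeasurableSpace.comap (R.F0 j) inferInstance ⊔ MeasurableSpace.comap (R.F1 j) inferInstance)
      ≤ history R.M R.F0 R.F1 (j + 1) :=
  le_iSup₂_of_le (f := fun i (_ : i < j + 1) => MeasurableSpace.comap (R.M i) inferInstance ⊔
      (MeasurableSpace.comap (R.F0 i) inferInstance ⊔
        MeasurableSpace.comap (R.F1 i) inferInstance)) j (Nat.lt_succ_self j) le_rfl

theorem halfHistory_le_history_succ (j : ℕ) :
    halfHistory R.M R.F0 R.F1 j ≤ history R.M R.F0 R.F1 (j + 1) :=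
  sup_le (R.history_mono j.le_succ) (le_sup_left.trans (R.comap_le_history_succ j))

theorem measurable_M_halfHistory (j : ℕ) : Measurable[halfHistory R.M R.F0 R.F1 j] (R.M j) :=
  Measurable.of_comap_le le_sup_right

theorem measurable_F0_history (j : ℕ) : Measurable[history R.M R.F0 R.F1 (j + 1)] (R.F0 j) :=
  Measurable.of_comap_le ((le_sup_left.trans le_sup_right).trans (R.comap_le_history_succ j))

theorem measurable_F1_history (j : ℕ) : Measurable[history R.M R.F0 R.F1 (j + 1)] (R.F1 j) :=
  Measurable.of_comap_le ((le_sup_right.trans le_sup_right).trans (R.comap_le_history_succ j))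

end Run

/-- Measurability of the success of an iteration. -/
theorem measurableSet_successful {Ω : Type*} {H : MeasurableSpace Ω} {n m : ℕ} (A : Params)
    {M : Ω → Model n m} {s : Ω → Vec n} {f0 f1 μ : Ω → ℝ} (hM : Measurable M)
    (hs : Measurable s) (h0 : Measurable f0) (h1 : Measurable f1) (hμ : Measurable μ) :
    MeasurableSet {ω | Successful A ⟨M ω, s ω, f0 ω, f1 ω⟩ (μ ω)} := by
  have hg : Measurable fun ω => (M ω).grad := hM.snd.fst
  have hj : Measurable fun ω => (M ω).jac := hM.snd.snd
  have hjs : Measurable fun ω => (M ω).jac (s ω) :=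
    (isBoundedBilinearMap_apply (𝕜 := ℝ) (E := Vec n) (F := Vec m)).continuous.measurable.comp
      (hj.prodMk hs)
  have hd : Measurable fun ω => (M ω).decrease (μ ω) (s ω) := by
    simp only [Model.decrease_eq]
    exact ((hg.inner hs).neg.sub ((hjs.norm.pow_const 2).const_mul _)).sub
      (((hμ.mul hg.norm).mul (hs.norm.pow_const 2)).const_mul _)
  exact (measurableSet_le measurable_const ((h0.sub h1).div hd)).inter
    (measurableSet_le (measurable_const.div hμ) hg.norm)

theorem measurableSet_modelAcc {Ω : Type*} {H : MeasurableSpace Ω} {n m : ℕ}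
    {r : Vec n → Vec m} (hr : ContDiff ℝ 1 r) (κef κeg : ℝ) {M : Ω → Model n m} {x : Ω → Vec n}
    {μ : Ω → ℝ} (hM : Measurable M) (hx : Measurable x) (hμ : Measurable μ) :
    MeasurableSet {ω | ‖(M ω).grad - jacTRes r (x ω)‖ ≤ κeg / μ ω ∧
      |obj r (x ω) - (M ω).val| ≤ κef / μ ω ^ 2} := by
  have hg : Measurable fun ω => (M ω).grad := hM.snd.fst
  have hv : Measurable fun ω => (M ω).val := hM.fst
  exact (measurableSet_le (hg.sub ((continuous_jacTRes hr).measurable.comp hx)).norm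
      (measurable_const.div hμ)).inter
    (measurableSet_le (continuous_abs.measurable.comp
      (((continuous_obj hr).measurable.comp hx).sub hv)) (measurable_const.div (hμ.pow_const 2)))

namespace Run

variable {Ω : Type*} [MeasurableSpace Ω] {n m : ℕ} (R : Run Ω n m)

theorem measurable_X_mu (j : ℕ) : Measurable[history R.M R.F0 R.F1 j] (R.X j) ∧
    Measurable[history R.M R.F0 R.F1 j] (R.mu j) := by
  classical
  induction j with
  | zero => exact ⟨measurable_const, measurable_const⟩
  | succ j ih =>
    have hX := ih.1.mono (R.history_mono j.le_succ) le_rfl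
    have hmu := ih.2.mono (R.history_mono j.le_succ) le_rfl
    have hM := (R.measurable_M_halfHistory j).mono (R.halfHistory_le_history_succ j) le_rfl
    have hS := (R.measurable_S j).mono (R.halfHistory_le_history_succ j) le_rfl
    have hsucc := measurableSet_successful R.A hM hS (R.measurable_F0_history j)
      (R.measurable_F1_history j) hmu
    constructor
    · have : R.X (j + 1) = fun ω => if Successful R.A (R.data j ω) (R.mu j ω) then
          R.X j ω + R.S j ω else R.X j ω := by
        ext1 ω; rw [X_succ, next]; split_ifs <;> rfl
      rw [this]
      exact Measurable.ite hsucc (hX.add hS) hX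
    · have : R.mu (j + 1) = fun ω => if Successful R.A (R.data j ω) (R.mu j ω) then
          max (R.mu j ω / R.A.lam) R.A.μmin else R.A.lam * R.mu j ω := by
        ext1 ω; rw [mu_succ, next]; split_ifs <;> rfl
      rw [this]
      exact Measurable.ite hsucc ((hmu.div_const _).max measurable_const) (hmu.const_mul _)

theorem measurableSet_modelAccurate {r : Vec n → Vec m} (hr : ContDiff ℝ 1 r) (κef κeg : ℝ)
    (j : ℕ) : MeasurableSet[halfHistory R.M R.F0 R.F1 j] (R.modelAccurate r κef κeg j) := by
  have hX := (R.measurable_X_mu j).1.mono (R.history_le_halfHistory j) le_rfl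
  have hmu := (R.measurable_X_mu j).2.mono (R.history_le_halfHistory j) le_rfl
  exact measurableSet_modelAcc hr κef κeg (R.measurable_M_halfHistory j) hX hmu

theorem measurableSet_estimatesAccurate {r : Vec n → Vec m} (hr : ContDiff ℝ 1 r) (εf : ℝ)
    (j : ℕ) : MeasurableSet (R.estimatesAccurate r εf j) := by
  have hX := (R.measurable_X_mu j).1.mono (R.history_le j) le_rfl
  have hmu := (R.measurable_X_mu j).2.mono (R.history_le j) le_rfl
  have hS := (R.measurable_S j).mono (R.halfHistory_le j) le_rfl
  have hf := (continuous_obj hr).measurable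
  exact (measurableSet_le (continuous_abs.measurable.comp ((R.measurable_F0 j).sub (hf.comp hX)))
      (measurable_const.div (hmu.pow_const 2))).inter
    (measurableSet_le (continuous_abs.measurable.comp ((R.measurable_F1 j).sub (hf.comp (hX.add hS))))
      (measurable_const.div (hmu.pow_const 2)))

end Run

/-! ### The level of the regularization parameter -/

/-- The number of steps on the grid `c λᶻ` from `c` up to `μ` (zero if `μ ≤ c`). -/
def Params.level (A : Params) (c μ : ℝ) : ℝ := max 0 (Real.logb A.lam (μ / c))

section Level

variable {A : Params} {c μ : ℝ}

theorem Params.level_nonneg : 0 ≤ A.level c μ := le_max_left _ _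

theorem Params.level_zpow (hc : 0 < c) (k : ℤ) : A.level c (c * A.lam ^ k) = max 0 (k : ℝ) := by
  have hl := A.one_lt_lam
  rw [Params.level, mul_div_cancel_left₀ _ hc.ne', ← Real.rpow_intCast,
    Real.logb_rpow (zero_lt_one.trans hl) hl.ne']

theorem max_zpow_zpow {l : ℝ} (hl : 1 < l) (a b : ℤ) : max (l ^ a) (l ^ b) = l ^ max a b :=
  ((zpow_right_strictMono₀ hl).monotone.map_max).symm

variable {n m : ℕ} {D : IterData n m} {x : Vec n} {t : ℕ}

theorem next_snd_zpow_of_successful (hc : 0 < c) (hμmin : A.μmin = c / A.lam ^ t) {k : ℤ}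
    (h : Successful A D (c * A.lam ^ k)) :
    (next A D x (c * A.lam ^ k)).2 = c * A.lam ^ max (k - 1) (-t : ℤ) := by
  have hl := A.one_lt_lam
  have hl0 : A.lam ≠ 0 := by positivity
  rw [next, if_pos h, hμmin, ← max_zpow_zpow hl, mul_max_of_nonneg _ _ hc.le, zpow_sub_one₀ hl0,
    zpow_neg, zpow_natCast, div_eq_mul_inv, div_eq_mul_inv, mul_assoc]

theorem next_snd_zpow_of_not_successful {k : ℤ}
    (h : ¬ Successful A D (c * A.lam ^ k)) :
    (next A D x (c * A.lam ^ k)).2 = c * A.lam ^ (k + 1) := by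
  have hl0 : A.lam ≠ 0 := by have := A.one_lt_lam; positivity
  rw [next, if_neg h, zpow_add_one₀ hl0]
  ring

/-- One step of the level, if accurate iterations at or above `c` are successful. -/
theorem level_next_le (hc : 0 < c) (ht : 0 < t) (hμmin : A.μmin = c / A.lam ^ t)
    (hk : ∃ k : ℤ, μ = c * A.lam ^ k) {Q : Prop} (hQ : Q → c ≤ μ → Successful A D μ) :
    A.level c (next A D x μ).2 ≤ A.level c μ + 1 ∧
    (Q → A.level c (next A D x μ).2 ≤
      A.level c μ + 1 - (2 - (Iic c).indicator (fun _ => 1) μ)) := by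
  obtain ⟨k, rfl⟩ := hk
  have hl := A.one_lt_lam
  have hkc : c * A.lam ^ k ≤ c ↔ k ≤ 0 := by
    rw [mul_le_iff_le_one_right hc, zpow_le_one_iff_right₀ hl]
  have hck : c ≤ c * A.lam ^ k ↔ 0 ≤ k := by
    rw [le_mul_iff_one_le_right hc, one_le_zpow_iff_right₀ hl]
  have ht' : (0 : ℝ) < t := by exact_mod_cast ht
  rw [Params.level_zpow hc]
  by_cases h : Successful A D (c * A.lam ^ k)
  · rw [next_snd_zpow_of_successful hc hμmin h, Params.level_zpow hc]
    -- The floor `μmin` corresponds to the exponent `-t`, below zero, so the level does not see it.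
    have hk' : max (0 : ℝ) ((max (k - 1) (-t : ℤ) : ℤ) : ℝ) = max 0 ((k : ℝ) - 1) := by
      push_cast
      rw [max_left_comm, max_eq_left (a := (0 : ℝ)) (by linarith), max_comm]
    rw [hk']
    refine ⟨?_, fun _ => ?_⟩
    · exact max_le (by positivity) (by linarith [le_max_right (0 : ℝ) k])
    · by_cases hk0 : k ≤ 0
      · have : (k : ℝ) ≤ 0 := by exact_mod_cast hk0
        rw [indicator_of_mem (mem_Iic.2 (hkc.2 hk0)), max_eq_left (by linarith), max_eq_left this]
        norm_num
      · have : (1 : ℝ) ≤ k := by exact_mod_cast not_le.1 hk0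
        rw [indicator_of_notMem (fun h => hk0 (hkc.1 (mem_Iic.1 h))), max_eq_right (by linarith),
          max_eq_right (by linarith)]
        linarith
  · rw [next_snd_zpow_of_not_successful h, Params.level_zpow hc]
    push_cast
    refine ⟨?_, fun hq => ?_⟩
    · exact max_le (by positivity) (by linarith [le_max_right (0 : ℝ) k])
    -- An accurate iteration can fail only strictly below `c`, and on the grid one increase from
    -- there does not pass `c`.
    · have hk0 : k + 1 ≤ 0 := by
        by_contra! hk0
        exact h (hQ hq (hck.2 (by omega)))
      have : (k : ℝ) + 1 ≤ 0 := by exact_mod_cast hk0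
      rw [indicator_of_mem (mem_Iic.2 (hkc.2 (by omega))), max_eq_left this, max_eq_left (by linarith)]
      norm_num

end Level

namespace Run

variable {Ω : Type*} [MeasurableSpace Ω] {n m : ℕ} {R : Run Ω n m}

/-- Both `μ₀` and the floor lie on the grid `c λᶻ`, which the updates preserve. Hence the level
takes integer values, and a success above `c` lowers it by exactly one. -/
theorem exists_mu_eq {c : ℝ} (hc : 0 < c) {s t : ℕ} (hμ₀ : R.μ₀ = c / R.A.lam ^ s)
    (hμmin : R.A.μmin = c / R.A.lam ^ t) (j : ℕ) (ω : Ω) :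
    ∃ k : ℤ, R.mu j ω = c * R.A.lam ^ k := by
  induction j with
  | zero => exact ⟨-s, by rw [mu_zero, hμ₀, zpow_neg, zpow_natCast, div_eq_mul_inv]⟩
  | succ j ih =>
    obtain ⟨k, hk⟩ := ih
    rw [mu_succ, hk]
    by_cases h : Successful R.A (R.data j ω) (c * R.A.lam ^ k)
    · exact ⟨_, next_snd_zpow_of_successful hc hμmin h⟩
    · exact ⟨_, next_snd_zpow_of_not_successful h⟩

theorem level_zero {c : ℝ} (hc : 0 < c) {s : ℕ} (hμ₀ : R.μ₀ = c / R.A.lam ^ s) (ω : Ω) :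
    R.A.level c (R.mu 0 ω) = 0 := by
  have : R.mu 0 ω = c * R.A.lam ^ (-s : ℤ) := by
    rw [mu_zero, hμ₀, zpow_neg, zpow_natCast, div_eq_mul_inv]
  rw [this, Params.level_zpow hc, max_eq_left]
  simp

theorem level_le {c : ℝ} (hc : 0 < c) {s t : ℕ} (ht : 0 < t) (hμ₀ : R.μ₀ = c / R.A.lam ^ s)
    (hμmin : R.A.μmin = c / R.A.lam ^ t) (j : ℕ) (ω : Ω) :
    R.A.level c (R.mu j ω) ≤ j := by
  induction j with
  | zero => rw [level_zero hc hμ₀, Nat.cast_zero]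
  | succ j ih =>
    have h := (level_next_le (D := R.data j ω) (x := R.X j ω) hc ht hμmin
      (exists_mu_eq hc hμ₀ hμmin j ω) (Q := False) False.elim).1
    rw [mu_succ]
    push_cast
    linarith

/-! ### The expected change of the potential -/

/-- The assumptions that hold for every realization. -/
structure Regular (R : Run Ω n m) (r : Vec n → Vec m) (K : Consts) (ζ τ : ℝ) : Prop where
  contDiff : ContDiff ℝ 1 r
  smooth : R.SmoothObjective r K.ν
  jac_le : R.BoundedJacobians K.κJ
  cauchy : R.CauchyDecrease K.θfcd
  step : R.StepBounds K.θin
  eta : K.EtaCondition R.A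
  C₂_pos : 0 < K.C₂ R.A
  zeta : K.ZetaCondition R.A ζ
  tau_mem : τ ∈ Ioo (0 : ℝ) 1
  tau : K.TauCondition R.A ζ τ

variable {r : Vec n → Vec m} {K : Consts} {ζ τ : ℝ}

namespace Regular

theorem scaledStep (hR : R.Regular r K ζ τ) (j : ℕ) (ω : Ω) :
    ScaledStep K (R.mu j ω * ‖(R.data j ω).M.grad‖) (R.mu j ω * ‖jacTRes r (R.X j ω)‖)
      (R.mu j ω * ‖(R.data j ω).s‖)
      (R.mu j ω ^ 2 * (R.data j ω).M.decrease (R.mu j ω) (R.data j ω).s)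
      (R.mu j ω ^ 2 * inner ℝ (R.data j ω).M.grad (R.data j ω).s)
      (R.mu j ω ^ 2 * inner ℝ (jacTRes r (R.X j ω)) (R.data j ω).s)
      (R.mu j ω ^ 2 * (obj r (R.X j ω + (R.data j ω).s) - obj r (R.X j ω))) := by
  obtain ⟨O, -, -, hO, -, hL⟩ := hR.smooth
  exact StochLM.scaledStep hR.contDiff (R.mu_pos j ω) (hL.mono (hO j ω)) (hR.jac_le j ω)
    (hR.cauchy j ω) (hR.step j ω).1 (hR.step j ω).2

theorem decrease_nonneg (hR : R.Regular r K ζ τ) (j : ℕ) (ω : Ω) :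
    0 ≤ (R.data j ω).M.decrease (R.mu j ω) (R.data j ω).s := by
  have hθ := K.θfcd_pos
  have hμ := R.mu_pos j ω
  exact le_trans (by rw [Model.reg]; positivity) (hR.cauchy j ω)

/-- Accurate iterations at a large rescaled gradient are successful. -/
theorem successful (hR : R.Regular r K ζ τ) {j : ℕ} {ω : Ω}
    (hU : ω ∈ R.modelAccurate r K.κef K.κeg j) (hV : ω ∈ R.estimatesAccurate r K.εf j)
    (hζ : ζ ≤ R.mu j ω * ‖jacTRes r (R.X j ω)‖) :
    Successful R.A (R.data j ω) (R.mu j ω) := by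
  have hμ := R.mu_pos j ω
  have h := ModelAcc.scaled (D := R.data j ω) hU.1 hμ
  exact successful_of_accurate hμ (hR.scaledStep j ω) rfl rfl hR.eta hR.zeta h.1 h.2 hV hζ

/-- The excess of the rescaled gradient over `ζ`. -/
def excess (R : Run Ω n m) (r : Vec n → Vec m) (ζ : ℝ) (j : ℕ) (ω : Ω) : ℝ :=
  max (R.mu j ω * ‖jacTRes r (R.X j ω)‖ - ζ) 0

theorem excess_nonneg {j : ℕ} {ω : Ω} : 0 ≤ excess R r ζ j ω := le_max_right _ _

/-- The case bounds are merged into the form required by `integral_le_of_two_stage`: the drop valid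
when at least one accuracy event holds is the baseline, and the indicators carry the corrections. On
the neither event the correction also cancels the baseline, which turns `λ² - 1` into `λ² - λ⁻²`. -/
theorem Phi_succ_sub_le (hR : R.Regular r K ζ τ) (j : ℕ) (ω : Ω) :
    R.Phi r τ (j + 1) ω - R.Phi r τ j ω ≤
      -((1 - τ) * (1 - 1 / R.A.lam ^ 2)) * (1 / R.mu j ω ^ 2)
      - τ * K.C₁ R.A * (excess R r ζ j ω / R.mu j ω ^ 2) *
        (R.modelAccurate r K.κef K.κeg j ∩ R.estimatesAccurate r K.εf j).indicator
          (fun _ => 1) ω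
      + (τ * K.C₃ ζ * (ζ * (1 / R.mu j ω ^ 2) + excess R r ζ j ω / R.mu j ω ^ 2) +
          (1 - τ) * (R.A.lam ^ 2 - 1 / R.A.lam ^ 2) * (1 / R.mu j ω ^ 2)) *
        ((R.modelAccurate r K.κef K.κeg j)ᶜ ∩ (R.estimatesAccurate r K.εf j)ᶜ).indicator
          (fun _ => 1) ω := by
  have hμ := R.mu_pos j ω
  have hchange : R.Phi r τ (j + 1) ω - R.Phi r τ j ω =
      potentialChange r R.A τ (R.data j ω) (R.X j ω) (R.mu j ω) := by
    rw [Phi, Phi, potentialChange, X_succ, mu_succ]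
  obtain ⟨h1, h2, h3⟩ := potentialChange_le (U := ω ∈ R.modelAccurate r K.κef K.κeg j)
    (V := ω ∈ R.estimatesAccurate r K.εf j) hμ (hR.decrease_nonneg j ω) (hR.scaledStep j ω)
    hR.eta hR.C₂_pos hR.zeta hR.tau_mem hR.tau
    (fun hU => ModelAcc.scaled (D := R.data j ω) hU.1 hμ) (fun hV => hV)
  rw [hchange]
  change _ → _ ≤ _ - τ * (K.C₁ R.A * excess R r ζ j ω) at h1
  change _ ≤ τ * (K.C₃ ζ * (ζ + excess R r ζ j ω)) + _ at h3
  set y := 1 / R.mu j ω ^ 2 with hy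
  have hy0 : 0 < y := by positivity
  have hμy : y * R.mu j ω ^ 2 = 1 := by rw [hy]; field_simp
  have hz : excess R r ζ j ω / R.mu j ω ^ 2 = y * excess R r ζ j ω := by rw [hy]; ring
  have key : ∀ c, R.mu j ω ^ 2 * potentialChange r R.A τ (R.data j ω) (R.X j ω) (R.mu j ω) ≤ c →
      potentialChange r R.A τ (R.data j ω) (R.X j ω) (R.mu j ω) ≤ y * c := fun c hc => by
    have := mul_le_mul_of_nonneg_left hc hy0.le
    rwa [← mul_assoc, hμy, one_mul] at this
  rw [hz]
  by_cases hU : ω ∈ R.modelAccurate r K.κef K.κeg j <;>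
    by_cases hV : ω ∈ R.estimatesAccurate r K.εf j
  · simp only [indicator, mem_inter_iff, mem_compl_iff, hU, hV, not_true_eq_false, and_self,
      if_true, if_false]
    linarith [key _ (h1 ⟨hU, hV⟩)]
  · simp only [indicator, mem_inter_iff, mem_compl_iff, hU, hV, not_true_eq_false,
      not_false_eq_true, and_false, false_and, if_false]
    linarith [key _ (h2 (Or.inl hU))]
  · simp only [indicator, mem_inter_iff, mem_compl_iff, hU, hV, not_true_eq_false,
      not_false_eq_true, and_false, false_and, if_false]
    linarith [key _ (h2 (Or.inr hV))]
  · simp only [indicator, mem_inter_iff, mem_compl_iff, hU, hV, not_false_eq_true, and_self,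
      if_true, if_false]
    linarith [key _ h3]

/-! #### Integrability -/

theorem measurable_excess (hR : R.Regular r K ζ τ) (j : ℕ) :
    Measurable[history R.M R.F0 R.F1 j] (excess R r ζ j) :=
  (((R.measurable_X_mu j).2.mul ((continuous_jacTRes hR.contDiff).norm.measurable.comp
    (R.measurable_X_mu j).1)).sub_const ζ).max measurable_const

/-- Steps have length at most `2 / μmin`, so `X_j` stays in a fixed compact ball on which the
gradient is bounded, and `μ_j ≤ μ₀ λʲ`. The bound depends on `j` and serves only integrability. -/
theorem exists_excess_le (hR : R.Regular r K ζ τ) (j : ℕ) : ∃ C, ∀ ω, excess R r ζ j ω ≤ C := by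
  obtain ⟨C, hC⟩ := (isCompact_closedBall R.x₀ (j * (2 / R.A.μmin))).exists_bound_of_continuousOn
    (continuous_jacTRes hR.contDiff).continuousOn
  have hμ₀ := R.A.μmin_pos.trans_le R.μmin_le
  have hl := R.A.one_lt_lam
  have hζ := Consts.zeta_pos hR.zeta
  refine ⟨max (R.μ₀ * R.A.lam ^ j * C) 0, fun ω => max_le_max ?_ le_rfl⟩
  have h1 := hC (R.X j ω) (by
    rw [mem_closedBall_iff_norm]
    exact R.norm_X_sub_le (fun j ω => (hR.step j ω).1) j ω)
  have h2 := mul_le_mul (R.mu_le j ω) h1 (norm_nonneg _) (by positivity)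
  linarith

theorem one_div_mu_sq_le (j : ℕ) (ω : Ω) : 1 / R.mu j ω ^ 2 ≤ 1 / R.A.μmin ^ 2 := by
  have h0 := R.A.μmin_pos
  have := R.μmin_le_mu j ω
  gcongr

variable {P : Measure Ω} [IsProbabilityMeasure P]

theorem integrable_one_div_mu_sq (j : ℕ) : Integrable (fun ω => 1 / R.mu j ω ^ 2) P :=
  integrable_of_nonneg_of_le
    ((((R.measurable_X_mu j).2.mono (R.history_le j) le_rfl).pow_const 2).const_div 1)
    (fun ω => by have := R.mu_pos j ω; positivity) (one_div_mu_sq_le j)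

theorem integrable_excess_div (hR : R.Regular r K ζ τ) (j : ℕ) :
    Integrable (fun ω => excess R r ζ j ω / R.mu j ω ^ 2) P := by
  obtain ⟨C, hC⟩ := hR.exists_excess_le j
  have h0 := R.A.μmin_pos
  refine integrable_of_nonneg_of_le (C := C * (1 / R.A.μmin ^ 2))
    (((hR.measurable_excess j).div ((R.measurable_X_mu j).2.pow_const 2)).mono
      (R.history_le j) le_rfl)
    (fun ω => div_nonneg excess_nonneg (sq_nonneg _)) fun ω => ?_
  rw [div_eq_mul_one_div]
  have := R.mu_pos j ω
  exact mul_le_mul (hC ω) (one_div_mu_sq_le j ω) (by positivity) (excess_nonneg.trans (hC ω))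

theorem Phi_nonneg (hτ : τ ∈ Ioo (0 : ℝ) 1) (j : ℕ) (ω : Ω) : 0 ≤ R.Phi r τ j ω := by
  have h1 := obj_nonneg r (R.X j ω)
  have h2 := hτ.1; have h3 := sub_pos.2 hτ.2
  unfold Phi
  positivity

theorem integrable_Phi (hR : R.Regular r K ζ τ) (hΦ : ∃ C, ∀ j ω, R.Phi r τ j ω ≤ C) (j : ℕ) :
    Integrable (R.Phi r τ j) P := by
  obtain ⟨C, hC⟩ := hΦ
  have hX := (R.measurable_X_mu j).1.mono (R.history_le j) le_rfl
  have hmu := (R.measurable_X_mu j).2.mono (R.history_le j) le_rfl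
  exact integrable_of_nonneg_of_le
    ((((continuous_obj hR.contDiff).measurable.comp hX).const_mul τ).add
      ((hmu.pow_const 2).const_div (1 - τ))) (Phi_nonneg hR.tau_mem j) (hC j)

theorem measurable_level (c : ℝ) (j : ℕ) : Measurable fun ω => R.A.level c (R.mu j ω) := by
  have hmu := (R.measurable_X_mu j).2.mono (R.history_le j) le_rfl
  exact measurable_const.max ((Real.measurable_log.comp (hmu.div_const c)).div_const _)

theorem integrable_level {c : ℝ} (hc : 0 < c) {s t : ℕ} (ht : 0 < t)
    (hμ₀ : R.μ₀ = c / R.A.lam ^ s) (hμmin : R.A.μmin = c / R.A.lam ^ t) (j : ℕ) :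
    Integrable (fun ω => R.A.level c (R.mu j ω)) P :=
  integrable_of_nonneg_of_le (measurable_level c j) (fun _ => Params.level_nonneg)
    (level_le hc ht hμ₀ hμmin j)

end Regular

end Run

/-! ### Drift of the augmented potential and the hitting time -/

theorem Params.sigma_pos (A : Params) {τ : ℝ} (hτ : τ < 1) : 0 < A.sigma τ := by
  have hl := A.one_lt_lam
  have h1 : 1 / A.lam ^ 2 < 1 := by
    rw [div_lt_one (by positivity)]; exact one_lt_pow₀ hl two_ne_zero
  have h2 := sub_pos.2 h1; have h3 := sub_pos.2 hτ
  unfold sigma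
  positivity

/-- The expected decrease of the potential, rescaled: the gain on accurate iterations outweighs
the loss on inaccurate ones. -/
theorem Consts.sigma_le {A : Params} {K : Consts} {ζ τ p q z : ℝ}
    (hζ : K.ZetaCondition A ζ) (hτ : τ ∈ Ioo (0 : ℝ) 1) (hp1 : p ≤ 1)
    (hq0 : 0 < q) (hq1 : q ≤ 1) (hpq : K.ProbCondition A ζ τ p q) (hz : 0 ≤ z) :
    A.sigma τ ≤ (1 - τ) * (1 - 1 / A.lam ^ 2) + p * q * (τ * K.C₁ A * z) -
      (1 - p) * (1 - q) *
        (τ * K.C₃ ζ * (ζ + z) + (1 - τ) * (A.lam ^ 2 - 1 / A.lam ^ 2)) := by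
  obtain ⟨h1, h2, h3⟩ := hpq
  have hC₁ := K.C₁_pos A
  have hC₃ := C₃_pos hζ
  have hζ0 := zeta_pos hζ
  have hτ0 := hτ.1; have hτ1 := sub_pos.2 hτ.2
  have hl := A.one_lt_lam
  have hw : 0 < (1 - τ) * (A.lam ^ 2 - 1) :=
    mul_pos hτ1 (sub_pos.2 (one_lt_pow₀ hl two_ne_zero))
  have hu : 0 < (1 - τ) * (1 - 1 / A.lam ^ 2) := by
    have := A.sigma_pos hτ.2
    unfold Params.sigma at this; linarith
  set β := (1 - p) * (1 - q) with hβ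
  have hβ0 : 0 ≤ β := mul_nonneg (sub_nonneg.2 hp1) (sub_nonneg.2 hq1)
  -- Put `u = (1 - τ)(1 - λ⁻²)`. The terms in `z` have a nonnegative sum by `h5`. Of `u`, at most
  -- half is lost to `β (τ C₃ ζ + (1 - τ)(λ² - 1))` by `h3` and at most a quarter to `β u`, leaving
  -- `u / 4 = σ`.
  have hβ1 : β ≤ 1 / 4 := by
    have hp : 1 / 2 < p := by nlinarith
    have hq : 1 / 2 < q := by nlinarith
    nlinarith
  rw [div_mul_eq_mul_div, div_le_iff₀ hC₁] at h2
  rw [le_div_iff₀ (by positivity)] at h3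
  have h4 : 0 ≤ τ * z := by positivity
  have h5 : β * K.C₃ ζ ≤ p * q * K.C₁ A := by nlinarith
  have h6 := mul_le_mul_of_nonneg_left h5 h4
  have h7 := mul_le_mul_of_nonneg_right hβ1 hu.le
  unfold Params.sigma
  linarith

namespace Run

variable {Ω : Type*} [MeasurableSpace Ω] {n m : ℕ}

/-- The event that the gradient exceeds `ε` at the iterates `0, …, j`. -/
def notHit (R : Run Ω n m) (r : Vec n → Vec m) (ε : ℝ) (j : ℕ) : Set Ω :=
  {ω | ∀ i ≤ j, ε < ‖jacTRes r (R.X i ω)‖}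

/-- The potential augmented by the level of the regularization parameter. -/
def augPhi (R : Run Ω n m) (r : Vec n → Vec m) (τ w c : ℝ) (j : ℕ) (ω : Ω) : ℝ :=
  w * R.Phi r τ j ω + R.A.level c (R.mu j ω)

variable {R : Run Ω n m} {r : Vec n → Vec m} {K : Consts} {ζ τ ε : ℝ}

theorem notHit_succ_subset (j : ℕ) : R.notHit r ε (j + 1) ⊆ R.notHit r ε j :=
  fun _ h i hi => h i (hi.trans j.le_succ)

theorem measurableSet_notHit (hr : ContDiff ℝ 1 r) (j : ℕ) :
    MeasurableSet[history R.M R.F0 R.F1 j] (R.notHit r ε j) := by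
  have h : R.notHit r ε j = ⋂ i, ⋂ _ : i ≤ j, {ω | ε < ‖jacTRes r (R.X i ω)‖} := by
    ext ω; simp [notHit]
  rw [h]
  exact MeasurableSet.iInter fun i => MeasurableSet.iInter fun hi =>
    measurableSet_lt measurable_const ((continuous_jacTRes hr).norm.measurable.comp
      ((R.measurable_X_mu i).1.mono (R.history_mono hi) le_rfl))

/-- The hitting time is the number of iterations before it. -/
theorem hit_le_tsum (hr : ContDiff ℝ 1 r) (ω : Ω) :
    (R.hit r ε ω : ℝ≥0∞) ≤ ∑' j, (R.notHit r ε j).indicator (fun _ => 1) ω := by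
  classical
  by_cases h : ∃ j, ‖jacTRes r (R.X j ω)‖ ≤ ε
  · have h1 : R.hit r ε ω ≤ (Nat.find h : ℕ∞) :=
      iInf₂_le _ (by rw [gradient_obj hr]; exact Nat.find_spec h)
    have h2 : ∑ j ∈ Finset.range (Nat.find h), (R.notHit r ε j).indicator (fun _ => (1 : ℝ≥0∞)) ω
        = Nat.find h := by
      rw [Finset.sum_congr rfl fun j hj => indicator_of_mem ?_ _]
      · simp
      · intro i hi
        exact not_le.1 (Nat.find_min h (hi.trans_lt (Finset.mem_range.1 hj)))
    calc (R.hit r ε ω : ℝ≥0∞) ≤ ((Nat.find h : ℕ∞) : ℝ≥0∞) := by gcongr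
      _ = (Nat.find h : ℝ≥0∞) := by simp
      _ ≤ _ := h2 ▸ ENNReal.sum_le_tsum _
  · push Not at h
    have h1 : ∀ j, (R.notHit r ε j).indicator (fun _ => (1 : ℝ≥0∞)) ω = 1 := fun j =>
      indicator_of_mem (show ω ∈ R.notHit r ε j from fun i _ => h i) _
    simp only [h1, ENNReal.tsum_const_eq_top_of_ne_zero one_ne_zero, le_top]

namespace Regular

variable {P : Measure Ω} [IsProbabilityMeasure P] {p q : ℝ}

/-- As long as the gradient exceeds `ε`, the augmented potential decreases on average. -/
theorem setIntegral_augPhi_succ_sub_le (hR : R.Regular r K ζ τ)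
    (hp1 : p ≤ 1) (hq0 : 0 < q) (hq1 : q ≤ 1)
    (hmodel : R.ProbModelAccurate P r K.κef K.κeg p)
    (hest : R.ProbEstimatesAccurate P r K.εf q)
    (hpq : K.ProbCondition R.A ζ τ p q)
    (hΦ : ∃ C, ∀ j ω, R.Phi r τ j ω ≤ C)
    (hε : 0 < ε) {s t : ℕ} (ht : 0 < t)
    (hμ₀ : R.μ₀ = (ζ / ε) / R.A.lam ^ s) (hμmin : R.A.μmin = (ζ / ε) / R.A.lam ^ t)
    {w : ℝ} (hw : w = p * q * (ζ / ε) ^ 2 / R.A.sigma τ) (j : ℕ) :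
    ∫ ω in R.notHit r ε j, (R.augPhi r τ w (ζ / ε) (j + 1) ω - R.augPhi r τ w (ζ / ε) j ω) ∂P ≤
      -(2 * (p * q) - 1) * P.real (R.notHit r ε j) := by
  set c := ζ / ε with hcdef
  have hζ0 := Consts.zeta_pos hR.zeta
  have hc : 0 < c := by positivity
  have hσ := R.A.sigma_pos hR.tau_mem.2
  have hpq0 : 0 < p * q := by linarith [hpq.1]
  have hw0 : 0 < w := by rw [hw]; positivity
  have hwσ : w * R.A.sigma τ = p * q * c ^ 2 := by rw [hw]; field_simp
  have hC₁ := K.C₁_pos R.A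
  have hC₃ := Consts.C₃_pos hR.zeta
  have hτ0 := hR.tau_mem.1; have hτ1 := sub_pos.2 hR.tau_mem.2
  have hl := R.A.one_lt_lam
  have hv : 0 ≤ (1 - τ) * (R.A.lam ^ 2 - 1 / R.A.lam ^ 2) := by
    refine mul_nonneg hτ1.le (sub_nonneg.2 ?_)
    rw [div_le_iff₀ (by positivity)]
    have := one_le_pow₀ (n := 2) hl.le
    nlinarith
  set E := R.notHit r ε j with hE
  have hEm : MeasurableSet[history R.M R.F0 R.F1 j] E := measurableSet_notHit hR.contDiff j
  have hEm' : MeasurableSet E := R.history_le j _ hEm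
  let low : Ω → ℝ := fun ω => (Iic c).indicator (fun _ => (1 : ℝ)) (R.mu j ω)
  have hlow : Measurable[history R.M R.F0 R.F1 j] low :=
    (measurable_const.indicator measurableSet_Iic).comp (R.measurable_X_mu j).2
  have hlow0 : ∀ ω, 0 ≤ low ω := fun ω => indicator_nonneg (fun _ _ => zero_le_one) _
  have hlow1 : ∀ ω, low ω ≤ 1 := fun ω => indicator_le_self' (fun _ _ => zero_le_one) _
  have hlowi : Integrable low P :=
    integrable_of_nonneg_of_le (hlow.mono (R.history_le j) le_rfl) hlow0 hlow1
  let y : Ω → ℝ := fun ω => 1 / R.mu j ω ^ 2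
  have hy : Measurable[history R.M R.F0 R.F1 j] y :=
    ((R.measurable_X_mu j).2.pow_const 2).const_div 1
  have hy0 : ∀ ω, 0 < y ω := fun ω => by have := R.mu_pos j ω; positivity
  have hyi : Integrable y P := integrable_one_div_mu_sq j
  let z : Ω → ℝ := fun ω => excess R r ζ j ω / R.mu j ω ^ 2
  have hz : Measurable[history R.M R.F0 R.F1 j] z :=
    (hR.measurable_excess j).div ((R.measurable_X_mu j).2.pow_const 2)
  have hz0 : ∀ ω, 0 ≤ z ω := fun ω => div_nonneg excess_nonneg (sq_nonneg _)
  have hzi : Integrable z P := hR.integrable_excess_div j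
  -- Baseline, gain and loss of the augmented potential. The `1` in `g₀` and the `2 - low` in `g₁`
  -- come from the level.
  let g₀ : Ω → ℝ := fun ω => 1 - w * ((1 - τ) * (1 - 1 / R.A.lam ^ 2)) * y ω
  let g₁ : Ω → ℝ := fun ω => w * (τ * K.C₁ R.A) * z ω + (2 - low ω)
  let g₂ : Ω → ℝ := fun ω => w * (τ * K.C₃ ζ) * (ζ * y ω + z ω) +
    w * ((1 - τ) * (R.A.lam ^ 2 - 1 / R.A.lam ^ 2)) * y ω
  have hg₁0 : ∀ ω, 0 ≤ g₁ ω := fun ω => by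
    have h1 := hz0 ω; have h2 := hlow1 ω
    have : 0 ≤ w * (τ * K.C₁ R.A) * z ω := by positivity
    simp only [g₁]; linarith
  have hg₂0 : ∀ ω, 0 ≤ g₂ ω := fun ω => by
    have h1 := hz0 ω; have h2 := (hy0 ω).le
    simp only [g₂]
    exact add_nonneg (by positivity) (mul_nonneg (mul_nonneg hw0.le hv) h2)
  have hg₀i : Integrable g₀ P := (integrable_const _).sub (hyi.const_mul _)
  have hg₁i : Integrable g₁ P := (hzi.const_mul _).add ((integrable_const _).sub hlowi)
  have hg₂i : Integrable g₂ P :=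
    (((hyi.const_mul _).add hzi).const_mul _).add (hyi.const_mul _)
  have hg₁m : Measurable[history R.M R.F0 R.F1 j] g₁ :=
    (hz.const_mul _).add (measurable_const.sub hlow)
  have hg₂m : Measurable[history R.M R.F0 R.F1 j] g₂ :=
    (((hy.const_mul _).add hz).const_mul _).add (hy.const_mul _)
  have hΨi : ∀ i, Integrable (R.augPhi r τ w c i) P := fun i =>
    ((hR.integrable_Phi hΦ i).const_mul w).add (integrable_level hc ht hμ₀ hμmin i)
  have hdiff : Integrable (fun ω => R.augPhi r τ w c (j + 1) ω - R.augPhi r τ w c j ω) P :=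
    (hΨi (j + 1)).sub (hΨi j)
  have main := integral_le_of_two_stage (P := P) (R.history_le_halfHistory j)
    (R.halfHistory_le j) (R.measurableSet_modelAccurate hR.contDiff K.κef K.κeg j)
    (R.measurableSet_estimatesAccurate hR.contDiff K.εf j) hq0.le hq1 (hmodel j) (hest j)
    (Y := E.indicator fun ω => R.augPhi r τ w c (j + 1) ω - R.augPhi r τ w c j ω)
    (c₀ := E.indicator g₀) (c₁ := E.indicator g₁) (c₂ := E.indicator g₂)
    (hdiff.indicator hEm') (hg₀i.indicator hEm')
    (hg₁m.indicator hEm) (indicator_nonneg fun ω _ => hg₁0 ω) (hg₁i.indicator hEm')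
    (hg₂m.indicator hEm) (indicator_nonneg fun ω _ => hg₂0 ω) (hg₂i.indicator hEm') ?_
  · rw [integral_indicator hEm'] at main
    refine main.trans ?_
    have hconst : -(2 * (p * q) - 1) * P.real E =
        ∫ ω, E.indicator (fun _ => -(2 * (p * q) - 1)) ω ∂P := by
      rw [integral_indicator_const _ hEm', smul_eq_mul, mul_comm]
    rw [hconst]
    refine integral_mono (((hg₀i.indicator hEm').sub ((hg₁i.indicator hEm').const_mul _)).add
      ((hg₂i.indicator hEm').const_mul _))
      ((integrable_const _).indicator hEm') fun ω => ?_
    by_cases hω : ω ∈ E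
    · simp only [indicator_of_mem hω, g₀, g₁, g₂]
      have hμ := R.mu_pos j ω
      have h1 := Consts.sigma_le hR.zeta hR.tau_mem hp1 hq0 hq1 hpq
        (excess_nonneg (R := R) (r := r) (ζ := ζ) (j := j) (ω := ω))
      have h2 := mul_le_mul_of_nonneg_left h1 (mul_nonneg hw0.le (hy0 ω).le)
      have hzy : z ω = y ω * excess R r ζ j ω := by simp only [z, y]; ring
      -- This is where `w` is fixed: `w σ = p q c²`, so for `μ ≤ c` the decrease of `w * Φ` covers
      -- the missing drop of the level.
      have h3 : p * q * low ω ≤ w * y ω * R.A.sigma τ := by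
        have h4 : w * y ω * R.A.sigma τ = p * q * (c ^ 2 * y ω) := by
          linear_combination y ω * hwσ
        rw [h4]
        refine mul_le_mul_of_nonneg_left ?_ hpq0.le
        by_cases hlowω : R.mu j ω ≤ c
        · simp only [low, indicator_of_mem (mem_Iic.2 hlowω), y]
          rw [mul_one_div, one_le_div (by positivity)]
          gcongr
        · simp only [low, indicator_of_notMem (fun h => hlowω (mem_Iic.1 h))]
          have := hy0 ω
          positivity
      rw [hzy]
      linarith
    · simp [indicator_of_notMem hω]
  · intro ω
    by_cases hω : ω ∈ E
    · simp only [indicator_of_mem hω]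
      have h1 := mul_le_mul_of_nonneg_left (hR.Phi_succ_sub_le j ω) hw0.le
      -- On `notHit` the gradient exceeds `ε`, and `c ε = ζ`.
      have hgrad : c ≤ R.mu j ω → ζ ≤ R.mu j ω * ‖jacTRes r (R.X j ω)‖ := fun h => by
        rw [hcdef, div_le_iff₀ hε] at h
        have h2 := hω j le_rfl
        have h3 := R.mu_pos j ω
        nlinarith
      obtain ⟨h2, h3⟩ := level_next_le (D := R.data j ω) (x := R.X j ω) hc ht hμmin
        (exists_mu_eq hc hμ₀ hμmin j ω)
        (Q := ω ∈ R.modelAccurate r K.κef K.κeg j ∩ R.estimatesAccurate r K.εf j)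
        fun h h' => hR.successful h.1 h.2 (hgrad h')
      rw [← mu_succ] at h2 h3
      have h4 : R.A.level c (R.mu (j + 1) ω) ≤ R.A.level c (R.mu j ω) + 1 - (2 - low ω) *
          (R.modelAccurate r K.κef K.κeg j ∩ R.estimatesAccurate r K.εf j).indicator
            (fun _ => 1) ω := by
        by_cases h : ω ∈ R.modelAccurate r K.κef K.κeg j ∩ R.estimatesAccurate r K.εf j
        · rw [indicator_of_mem h, mul_one]; exact h3 h
        · rw [indicator_of_notMem h, mul_zero, sub_zero]; exact h2
      simp only [augPhi, g₀, g₁, g₂, y, z]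
      linarith
    · simp [indicator_of_notMem hω]

/-- The expected number of iterations before the gradient falls to `ε`. -/
theorem mul_sum_notHit_le (hR : R.Regular r K ζ τ)
    (hp1 : p ≤ 1) (hq0 : 0 < q) (hq1 : q ≤ 1)
    (hmodel : R.ProbModelAccurate P r K.κef K.κeg p)
    (hest : R.ProbEstimatesAccurate P r K.εf q)
    (hpq : K.ProbCondition R.A ζ τ p q)
    (hΦ : ∃ C, ∀ j ω, R.Phi r τ j ω ≤ C)
    (hε : 0 < ε) {s t : ℕ} (ht : 0 < t)
    (hμ₀ : R.μ₀ = (ζ / ε) / R.A.lam ^ s) (hμmin : R.A.μmin = (ζ / ε) / R.A.lam ^ t) (N : ℕ) :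
    (2 * (p * q) - 1) * ∑ j ∈ Finset.range N, P.real (R.notHit r ε j) ≤
      p * q * (ζ / ε) ^ 2 / R.A.sigma τ *
        (τ * obj r R.x₀ + (1 - τ) / R.μ₀ ^ 2) := by
  have hζ0 := Consts.zeta_pos hR.zeta
  have hc : 0 < ζ / ε := by positivity
  have hσ := R.A.sigma_pos hR.tau_mem.2
  have hpq0 : 0 < p * q := by linarith [hpq.1]
  set w := p * q * (ζ / ε) ^ 2 / R.A.sigma τ with hw
  have hw0 : 0 < w := by positivity
  have hΨi : ∀ i, Integrable (R.augPhi r τ w (ζ / ε) i) P := fun i =>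
    ((hR.integrable_Phi hΦ i).const_mul w).add (integrable_level hc ht hμ₀ hμmin i)
  have hΨ0 : ∀ i ω, 0 ≤ R.augPhi r τ w (ζ / ε) i ω := fun i ω =>
    add_nonneg (mul_nonneg hw0.le (Phi_nonneg hR.tau_mem i ω)) Params.level_nonneg
  have hstep : ∀ j, ∫ ω in R.notHit r ε j, R.augPhi r τ w (ζ / ε) (j + 1) ω ∂P ≤
      ∫ ω in R.notHit r ε j, R.augPhi r τ w (ζ / ε) j ω ∂P -
        (2 * (p * q) - 1) * P.real (R.notHit r ε j) := fun j => by
    have h := hR.setIntegral_augPhi_succ_sub_le hp1 hq0 hq1 hmodel hest hpq hΦ hε ht hμ₀ hμmin hw j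
    rw [integral_sub (hΨi _).integrableOn (hΨi _).integrableOn] at h
    linarith
  -- Nonnegativity of the augmented potential allows the domain of integration to shrink from one
  -- iteration to the next, so the drift inequalities telescope.
  have hmono : ∀ j, ∫ ω in R.notHit r ε (j + 1), R.augPhi r τ w (ζ / ε) (j + 1) ω ∂P ≤
      ∫ ω in R.notHit r ε j, R.augPhi r τ w (ζ / ε) (j + 1) ω ∂P := fun j =>
    setIntegral_mono_set (hΨi _).integrableOn
      (Filter.Eventually.of_forall fun ω => hΨ0 _ ω) (notHit_succ_subset j).eventuallyLE
  have hsum : (2 * (p * q) - 1) * ∑ j ∈ Finset.range N, P.real (R.notHit r ε j) +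
      ∫ ω in R.notHit r ε N, R.augPhi r τ w (ζ / ε) N ω ∂P ≤
        ∫ ω in R.notHit r ε 0, R.augPhi r τ w (ζ / ε) 0 ω ∂P := by
    induction N with
    | zero => simp
    | succ N ih =>
      rw [Finset.sum_range_succ, mul_add]
      linarith [hstep N, hmono N]
  have hzero : ∀ ω, R.augPhi r τ w (ζ / ε) 0 ω =
      w * (τ * obj r R.x₀ + (1 - τ) / R.μ₀ ^ 2) := fun ω => by
    rw [augPhi, level_zero hc hμ₀, add_zero]; rfl
  have h0 : ∫ ω in R.notHit r ε 0, R.augPhi r τ w (ζ / ε) 0 ω ∂P ≤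
      ∫ ω, R.augPhi r τ w (ζ / ε) 0 ω ∂P :=
    setIntegral_le_integral (hΨi 0) (Filter.Eventually.of_forall fun ω => hΨ0 0 ω)
  have hN : 0 ≤ ∫ ω in R.notHit r ε N, R.augPhi r τ w (ζ / ε) N ω ∂P :=
    integral_nonneg fun ω => hΨ0 N ω
  have h00 : ∫ ω, R.augPhi r τ w (ζ / ε) 0 ω ∂P =
      w * (τ * obj r R.x₀ + (1 - τ) / R.μ₀ ^ 2) := by
    simp only [hzero, integral_const, probReal_univ, one_smul]
  linarith

theorem lintegral_hit_le (hR : R.Regular r K ζ τ)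
    (hp1 : p ≤ 1) (hq0 : 0 < q) (hq1 : q ≤ 1)
    (hmodel : R.ProbModelAccurate P r K.κef K.κeg p)
    (hest : R.ProbEstimatesAccurate P r K.εf q)
    (hpq : K.ProbCondition R.A ζ τ p q)
    (hΦ : ∃ C, ∀ j ω, R.Phi r τ j ω ≤ C)
    (hε : 0 < ε) {s t : ℕ} (ht : 0 < t)
    (hμ₀ : R.μ₀ = (ζ / ε) / R.A.lam ^ s) (hμmin : R.A.μmin = (ζ / ε) / R.A.lam ^ t) :
    ∫⁻ ω, (R.hit r ε ω : ℝ≥0∞) ∂P ≤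
      ENNReal.ofReal (p * q / (2 * (p * q) - 1) *
        ((τ * obj r R.x₀ + (1 - τ) / R.μ₀ ^ 2) / R.A.sigma τ * (ζ / ε) ^ 2)) := by
  have hm : ∀ j, MeasurableSet (R.notHit r ε j) := fun j =>
    R.history_le j _ (measurableSet_notHit hR.contDiff j)
  have hpos : 0 < 2 * (p * q) - 1 := by linarith [hpq.1]
  calc ∫⁻ ω, (R.hit r ε ω : ℝ≥0∞) ∂P
      ≤ ∫⁻ ω, ∑' j, (R.notHit r ε j).indicator (fun _ => 1) ω ∂P :=
        lintegral_mono fun ω => hit_le_tsum hR.contDiff ω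
    _ = ∑' j, P (R.notHit r ε j) := by
        rw [lintegral_tsum fun j => (measurable_const.indicator (hm j)).aemeasurable]
        exact tsum_congr fun j => lintegral_indicator_one (hm j)
    _ ≤ _ := ENNReal.tsum_le_of_sum_range_le fun N => by
        have h := hR.mul_sum_notHit_le (P := P) hp1 hq0 hq1 hmodel hest hpq hΦ hε ht hμ₀ hμmin N
        rw [mul_comm, ← le_div_iff₀ hpos] at h
        rw [Finset.sum_congr rfl fun j _ =>
          (ofReal_measureReal (measure_ne_top P (R.notHit r ε j))).symm,
          ← ENNReal.ofReal_sum_of_nonneg fun _ _ => measureReal_nonneg]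
        refine ENNReal.ofReal_le_ofReal (h.trans_eq ?_)
        ring

end Regular

end Run

end StochLM

end

theorem theorem5p1 {Ω : Type*} [MeasurableSpace Ω] (P : Measure Ω) [IsProbabilityMeasure P]
    {n m : ℕ} (r : StochLM.Vec n → StochLM.Vec m) (hr : ContDiff ℝ 1 r)
    (R : StochLM.Run Ω n m) (K : StochLM.Consts)
    (hf : R.SmoothObjective r K.ν)
    (hJ : R.BoundedJacobians K.κJ)
    (hdec : R.CauchyDecrease K.θfcd)
    (hstep : R.StepBounds K.θin)
    (hη₂ : K.EtaCondition R.A) (hC₂ : 0 < K.C₂ R.A)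
    (p q : ℝ) (hp : p ∈ Set.Ioc (0 : ℝ) 1) (hq : q ∈ Set.Ioc (0 : ℝ) 1)
    (hmodel : R.ProbModelAccurate P r K.κef K.κeg p)
    (hest : R.ProbEstimatesAccurate P r K.εf q)
    (ζ τ : ℝ) (hζ : K.ZetaCondition R.A ζ)
    (hτ : τ ∈ Set.Ioo (0 : ℝ) 1) (hτ' : K.TauCondition R.A ζ τ)
    (hpq : K.ProbCondition R.A ζ τ p q)
    (hΦ : ∃ Φmax : ℝ, 0 < Φmax ∧ ∀ j ω, R.Phi r τ j ω ≤ Φmax)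
    (ε : ℝ) (hε : 0 < ε)
    (s t : ℕ) (hs : 0 < s) (ht : 0 < t)
    (hμ₀ : R.μ₀ = (ζ / ε) / R.A.lam ^ s)
    (hμmin : R.A.μmin = (ζ / ε) / R.A.lam ^ t) :
    ∫⁻ ω, (R.hit r ε ω : ℝ≥0∞) ∂P ≤
        ENNReal.ofReal (p * q / (2 * (p * q) - 1) *
          ((τ * StochLM.obj r R.x₀ + (1 - τ) / R.μ₀ ^ 2) / R.A.sigma τ * (ζ / ε) ^ 2 + 1) - 1) ∧
      ∫⁻ ω, (R.hit r ε ω : ℝ≥0∞) ∂P ≤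
        ENNReal.ofReal (p * q / (2 * (p * q) - 1) *
          ((τ * StochLM.obj r R.x₀ + (1 - τ) * R.μ₀ ^ (-2 : ℤ)) /
              (1 / 4 * (1 - τ) * (1 - 1 / R.A.lam ^ 2)) * ζ ^ 2 * ε ^ (-2 : ℤ) + 1) - 1) := by
  have hR : R.Regular r K ζ τ := ⟨hr, hf, hJ, hdec, hstep, hη₂, hC₂, hζ, hτ, hτ'⟩
  have hbound := hR.lintegral_hit_le hp.2 hq.1 hq.2 hmodel hest hpq
    (hΦ.imp fun _ h => h.2) hε ht hμ₀ hμmin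
  have hpos : 0 < 2 * (p * q) - 1 := by linarith [hpq.1]
  -- The drift argument gives the bound without the `+ 1` and `- 1`. Their net contribution is
  -- nonnegative because `p q ≤ 1`.
  have hone : 1 ≤ p * q / (2 * (p * q) - 1) := by
    rw [one_le_div hpos]
    linarith [mul_le_one₀ hp.2 hq.1.le hq.2]
  have hfirst := hbound.trans (ENNReal.ofReal_le_ofReal
    (q := p * q / (2 * (p * q) - 1) *
      ((τ * StochLM.obj r R.x₀ + (1 - τ) / R.μ₀ ^ 2) / R.A.sigma τ * (ζ / ε) ^ 2 + 1) - 1)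
    (by linarith))
  refine ⟨hfirst, hfirst.trans_eq ?_⟩
  have hpow : ∀ x : ℝ, x ^ (-2 : ℤ) = (x ^ 2)⁻¹ := fun x => by
    rw [zpow_neg]; norm_cast
  rw [StochLM.Params.sigma, hpow, hpow, div_pow]
  congr 2
  ring
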